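/- **Setting.** All Hilbert spaces are nonzero and finite-dimensional. A resource theory (for fixed input and output systems) is a set $\mathbb{O}_{\rm all}$ of quantum channels (the allowed channels) with a nonempty, convex, closed subset $\mathbb{O}\subseteq\mathbb{O}_{\rm all}$ (the free channels). Let $(\mathbb{O}_{\rm all},\mathbb{O})$ and $(\mathbb{O}'_{\rm all},\mathbb{O}')$ be two such theories. A superchannel is a map of the form $\Theta(\mathcal L)=\mathcal{P}_{\rm post}\circ(\mathrm{id}\otimes\mathcal L)\circ\mathcal{P}_{\rm pre}$, with channels $\mathcal P_{\rm pre},\mathcal P_{\rm post}$ and a finite-dimensional memory system on which $\mathrm{id}$ acts. Let $\mathbb{S}$ be the set of free superchannels, i.e. superchannels with $\Theta(\mathbb{O}_{\rm all})\subseteq\mathbb{O}'_{\rm all}$ and $\Theta(\mathbb{O})\subseteq\mathbb{O}'$. For channels let $F(\mathcal{E}_1,\mathcal{E}_2)=\min_\rho F(\mathrm{id}\otimes\mathcal{E}_1(\rho),\mathrm{id}\otimes\mathcal{E}_2(\rho))$, the minimum being over all states $\rho$ of the input system and a finite-dimensional ancilla, where $F(\rho,\sigma)=\|\sqrt\rho\sqrt\sigma\|_1^2$.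 A monotone $\mathfrak R$ assigns extended real values $\mathfrak{R}_{\mathbb{O}}(\mathcal{L})$ to channels $\mathcal L\in\mathbb{O}_{\rm all}$ and $\mathfrak{R}_{\mathbb{O}'}(\mathcal{L}')$ to channels $\mathcal L'\in\mathbb{O}'_{\rm all}$ such that $\mathfrak{R}_{\mathbb{O}'}(\Theta(\mathcal L))\le\mathfrak{R}_{\mathbb{O}}(\mathcal L)$ for all $\Theta\in\mathbb{S}$, $\mathcal L\in\mathbb{O}_{\rm all}$. For a function $\mathfrak{R}_{\mathbb{O}}$ on $\mathbb{O}_{\rm all}$ and $\epsilon\ge0$, its smoothed version is $\mathfrak{R}^\epsilon_{\mathbb{O}}(\mathcal{E})=\inf\{\mathfrak{R}_{\mathbb{O}}(\mathcal{E}')\mid \mathcal{E}'\in\mathbb{O}_{\rm all},\ F(\mathcal{E}',\mathcal{E})\ge1-\epsilon\}$, and similarly for $\mathbb{O}'$, $\mathbb{O}'_{\rm all}$. For $\mathbb{O}\subseteq\tilde{\mathbb{O}}\subseteq\mathbb{O}_{\rm all}$ put $R_{\mathbb{O};\tilde{\mathbb{O}}}(\mathcal{E})=\inf\{1+r\mid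 r\ge0,\ \exists\,\mathcal{M}\in\tilde{\mathbb{O}}:\ \tfrac{\mathcal{E}+r\mathcal{M}}{1+r}\in\mathbb{O}\}\in[1,\infty]$, and let $R_{s,\mathbb{O}}=R_{\mathbb{O};\mathbb{O}}$ and $R_{\max,\mathbb{O}}=R_{\mathbb{O};\mathbb{O}_{\rm all}}$. For a set $S$ of trace-preserving linear maps put $$R_{H,S}^\delta(\mathcal{E})=\inf_{\mathcal{M}\in S}\ \sup_{\psi}\ \sup_{\substack{0\le P\le 1\\ \operatorname{Tr}(P\,\mathrm{id}\otimes\mathcal{E}(\psi))\ge1-\delta}}\ \frac{1}{\operatorname{Tr}(P\,\mathrm{id}\otimes\mathcal{M}(\psi))}\in[1,\infty],$$ where $\psi$ ranges over the pure states of two copies of the input system and the fraction is read as $\infty$ when its denominator is $\le 0$. Let $\mathrm{aff}(\mathbb{O})$ be the real affine hull of $\mathbb{O}$ in the space of linear maps. **Theorem.** Let $\mathcal{E}\in\mathbb{O}_{\rm all}$ and $\mathcal{N}\in\mathbb{O}'_{\rm all}$. (1) Let $\epsilon\ge0$. If there is $\Theta\in\mathbb{S}$ with $F(\Theta(\mathcal{E}),\mathcal{N})\ge1-\epsilon$,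 then every monotone satisfies $\mathfrak{R}_{\mathbb{O}}(\mathcal{E})\ge\mathfrak{R}^\epsilon_{\mathbb{O}'}(\mathcal{N})$ and, for every $0\le\delta\le1$, $\mathfrak{R}^\delta_{\mathbb{O}}(\mathcal{E})\ge\mathfrak{R}^{2(\sqrt\delta+\sqrt\epsilon)}_{\mathbb{O}'}(\mathcal{N})$. (2) Suppose that $\mathbb{O}'_{\rm all}$ is convex and closed. Let $\epsilon,\delta\ge0$ with $\epsilon+2\delta<1$. If $R^\delta_{H,\mathbb{O}}(\mathcal{E})\ge R^\epsilon_{s,\mathbb{O}'}(\mathcal{N})$, or if $R^\delta_{H,\mathrm{aff}(\mathbb{O})}(\mathcal{E})\ge R^\epsilon_{\max,\mathbb{O}'}(\mathcal{N})$, then there is $\Theta\in\mathbb{S}$ with $F(\Theta(\mathcal{E}),\mathcal{N})\ge1-\epsilon-2\delta$. -/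

import Mathlib

noncomputable section

namespace ChannelResource

open scoped MatrixOrder ComplexOrder ENNReal NNReal

/-- Linear maps from operators on `ℂⁿ` to operators on `ℂᵐ`. -/
abbrev SuperOp (n m : Type*) [Fintype n] [Fintype m] : Type _ :=
  Matrix n n ℂ →ₗ[ℂ] Matrix m m ℂ

/-- The map `id ⊗ Φ` on operators on `ℂᵏ ⊗ ℂⁿ`: it applies `Φ` to every `n × n` block. -/
def idTensor (k : Type*) [Fintype k] {n m : Type*} [Fintype n] [Fintype m]
    (Φ : SuperOp n m) : SuperOp (k × n) (k × m) where
  toFun X := Matrix.of fun p q => Φ (Matrix.of fun i j => X (p.1, i) (q.1, j)) p.2 q.2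
  map_add' X Y := by
    ext p q
    exact congrFun (congrFun (Φ.map_add (Matrix.of fun i j => X (p.1, i) (q.1, j))
      (Matrix.of fun i j => Y (p.1, i) (q.1, j))) p.2) q.2
  map_smul' c X := by
    ext p q
    exact congrFun (congrFun (Φ.map_smul c (Matrix.of fun i j => X (p.1, i) (q.1, j))) p.2) q.2

/-- A quantum channel: a completely positive trace-preserving linear map. -/
structure IsChannel {n m : Type*} [Fintype n] [Fintype m] (Φ : SuperOp n m) : Prop where
  completelyPositive : ∀ (k : ℕ) (X : Matrix (Fin k × n) (Fin k × n) ℂ),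
    X.PosSemidef → (idTensor (Fin k) Φ X).PosSemidef
  tracePreserving : ∀ X : Matrix n n ℂ, (Φ X).trace = X.trace

/-- Density matrices (quantum states). -/
def IsState {n : Type*} [Fintype n] (ρ : Matrix n n ℂ) : Prop :=
  ρ.PosSemidef ∧ ρ.trace = 1

/-- The trace norm `‖A‖₁ = Tr √(A† A)`. -/
def traceNorm {n : Type*} [Fintype n] [DecidableEq n] (A : Matrix n n ℂ) : ℝ :=
  (CFC.sqrt (A.conjTranspose * A)).trace.re

/-- The fidelity `F(ρ, σ) = ‖√ρ √σ‖₁²` of states. -/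
def stateFidelity {n : Type*} [Fintype n] [DecidableEq n] (ρ σ : Matrix n n ℂ) : ℝ :=
  traceNorm (CFC.sqrt ρ * CFC.sqrt σ) ^ 2

/-- The worst-case fidelity of two channels, minimised over all input states, with an
ancilla of any finite dimension. -/
def channelFidelity {n m : Type*} [Fintype n] [Fintype m] [DecidableEq m]
    (Φ Ψ : SuperOp n m) : ℝ :=
  sInf {f : ℝ | ∃ (k : ℕ) (ρ : Matrix (Fin k × n) (Fin k × n) ℂ), IsState ρ ∧
    f = stateFidelity (idTensor (Fin k) Φ ρ) (idTensor (Fin k) Ψ ρ)}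

/-- A quantum superchannel: a transformation of channels `n → m` into channels `n' → m'` of
the form `L ↦ post ∘ (id ⊗ L) ∘ pre` with channels `pre` and `post` and a finite-dimensional
memory. -/
def IsSuperchannel {n m n' m' : Type*} [Fintype n] [Fintype m] [Fintype n'] [Fintype m']
    (Θ : SuperOp n m → SuperOp n' m') : Prop :=
  ∃ (k : ℕ) (pre : SuperOp n' (Fin k × n)) (post : SuperOp (Fin k × m) m'),
    IsChannel pre ∧ IsChannel post ∧
      ∀ L : SuperOp n m, Θ L = post ∘ₗ idTensor (Fin k) L ∘ₗ pre

/-- A resource theory of channels with fixed input and output systems: a set `allowed` of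
channels and a nonempty convex closed subset `free`. Closedness is that of the
finite-dimensional space of linear maps, whose topology is that of pointwise convergence. -/
structure ResourceTheory (n m : Type*) [Fintype n] [Fintype m] where
  allowed : Set (SuperOp n m)
  free : Set (SuperOp n m)
  allowed_isChannel : ∀ Φ ∈ allowed, IsChannel Φ
  free_subset : free ⊆ allowed
  free_nonempty : free.Nonempty
  free_convex : Convex ℝ free
  free_closed : IsClosed ((fun (Φ : SuperOp n m) (X : Matrix n n ℂ) => Φ X) '' free)

/-- The free superchannels: superchannels that map allowed channels to allowed channels and
free channels to free channels. -/
def freeSuperchannels {n m n' m' : Type*} [Fintype n] [Fintype m] [Fintype n'] [Fintype m']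
    (T : ResourceTheory n m) (T' : ResourceTheory n' m') :
    Set (SuperOp n m → SuperOp n' m') :=
  {Θ | IsSuperchannel Θ ∧ (∀ L ∈ T.allowed, Θ L ∈ T'.allowed) ∧ ∀ M ∈ T.free, Θ M ∈ T'.free}

/-- A pair of extended-real valued functions (on the channels of the input theory and on those
of the output theory) is a resource monotone if no free superchannel increases its value. -/
def IsMonotone {n m n' m' : Type*} [Fintype n] [Fintype m] [Fintype n'] [Fintype m']
    (T : ResourceTheory n m) (T' : ResourceTheory n' m')
    (R : SuperOp n m → EReal) (R' : SuperOp n' m' → EReal) : Prop :=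
  ∀ Θ ∈ freeSuperchannels T T', ∀ L ∈ T.allowed, R' (Θ L) ≤ R L

/-- The smoothed version of a resource measure `R`: its infimum over the allowed channels whose
fidelity with the given channel is at least `1 - ε`. -/
def smooth {n m : Type*} [Fintype n] [Fintype m] [DecidableEq m] {V : Type*} [CompleteLattice V]
    (T : ResourceTheory n m) (R : SuperOp n m → V) (ε : ℝ) (Φ : SuperOp n m) : V :=
  sInf {v : V | ∃ Φ' ∈ T.allowed, 1 - ε ≤ channelFidelity Φ' Φ ∧ v = R Φ'}

/-- The robustness of `Φ` with respect to the set `O`, with noise from the set `O₂`. -/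
def robustness {n m : Type*} [Fintype n] [Fintype m] (O O₂ : Set (SuperOp n m))
    (Φ : SuperOp n m) : ℝ≥0∞ :=
  sInf {v : ℝ≥0∞ | ∃ r : ℝ, 0 ≤ r ∧ (∃ M ∈ O₂, (1 + r)⁻¹ • (Φ + r • M) ∈ O) ∧
    v = ENNReal.ofReal (1 + r)}

/-- The standard robustness. -/
def standardRobustness {n m : Type*} [Fintype n] [Fintype m] (T : ResourceTheory n m) :
    SuperOp n m → ℝ≥0∞ :=
  robustness T.free T.free

/-- The generalized robustness. -/
def maxRobustness {n m : Type*} [Fintype n] [Fintype m] (T : ResourceTheory n m) :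
    SuperOp n m → ℝ≥0∞ :=
  robustness T.free T.allowed

/-- The hypothesis testing measure `sup 1 / Tr(P σ)` over the tests `0 ≤ P ≤ 1` with
`Tr(P ρ) ≥ 1 - ε`. The value is `∞` if `Tr(P σ)` can be made nonpositive. Negative values only
occur for an operator `σ` that is not positive semidefinite; if `Tr σ = 1`, then (moving `P`
towards `1`) the reciprocals of positive values of `Tr(P σ)` are unbounded as well. -/
def hypTest {n : Type*} [Fintype n] [DecidableEq n] (ε : ℝ) (ρ σ : Matrix n n ℂ) : ℝ≥0∞ :=
  ⨆ (P : Matrix n n ℂ) (_ : P.PosSemidef ∧ (1 - P).PosSemidef ∧ 1 - ε ≤ (P * ρ).trace.re),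
    (ENNReal.ofReal (P * σ).trace.re)⁻¹

/-- The rank-one operator `|ψ⟩⟨ψ|`. -/
def ketbra {n : Type*} (ψ : n → ℂ) : Matrix n n ℂ :=
  Matrix.vecMulVec ψ (star ψ)

/-- The channel hypothesis testing measure of `Φ` with respect to a set `S` of linear maps: the
infimum over `M ∈ S` of the supremum over all pure states `ψ` of two copies of the input system
of `hypTest ε (id ⊗ Φ(ψ)) (id ⊗ M(ψ))`. -/
def hypTestMeasure {n m : Type*} [Fintype n] [DecidableEq n] [Fintype m] [DecidableEq m]
    (S : Set (SuperOp n m)) (ε : ℝ) (Φ : SuperOp n m) : ℝ≥0∞ :=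
  ⨅ M ∈ S, ⨆ (ψ : n × n → ℂ) (_ : star ψ ⬝ᵥ ψ = 1),
    hypTest ε (idTensor n Φ (ketbra ψ)) (idTensor n M (ketbra ψ))

end ChannelResource

end

noncomputable section

namespace ChannelResource

open scoped MatrixOrder ComplexOrder ENNReal NNReal Kronecker

open Matrix

/-! Necessary conditions. If `L` is close to `E`, then `Θ L` is close to `Θ E` because fidelity does
not decrease under superchannels, and `Θ E` is close to `N`. A triangle inequality then makes `Θ L`
a candidate in the smoothed measure of `N`, and monotonicity bounds its value by that of `L`.
Everything about fidelity comes from Uhlmann's theorem in matrix form: the root fidelity is the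
largest real overlap `Re Tr (X Yᴴ)` over factorizations `ρ = X Xᴴ`, `σ = Y Yᴴ`.

Sufficient conditions. The superchannel is measure-and-prepare: test the given channel on a fixed
input state, then apply `N'` on acceptance and `M'` on rejection. By compactness there is an optimal
free mixture `p N' + (1 - p) M'`, where `N'` is within `ε` of `N` and `1 / p` is the smoothed
robustness (`exists_optimal_mixture`). The hypothesis on `R_H` must supply one test that accepts `E`
with probability at least `1 - δ` and every free channel with probability at most `p`. - Standard
robustness: `M'` is free, so an acceptance probability `a ≤ p` gives a channel on the segment from
`M'` to the free mixture. - Generalized robustness: `M'` need not be free, so probability exactly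
`p` is needed. A functional bounded on an affine hull is constant on the set, and mixing in the test
that always accepts raises this constant to `p`.

The definition of `R_H` allows the test to depend on the free map. Pairs of an input state and a
test do not form a convex set, but the operators they induce on the Choi space do: these are the
`testers`, a compact convex set on which acceptance is bilinear. Minimax then gives one tester for
all free maps (`exists_tester_forall_accept_le`). -/

/-- The positive semidefinite square root squares to the matrix. -/
theorem sqrt_mul_sqrt {n : Type*} [Fintype n] [DecidableEq n] {A : Matrix n n ℂ}
    (hA : A.PosSemidef) : CFC.sqrt A * CFC.sqrt A = A :=
  CFC.sqrt_mul_sqrt_self A hA.nonneg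

theorem sqrt_posSemidef {n : Type*} [Fintype n] [DecidableEq n] (A : Matrix n n ℂ) :
    (CFC.sqrt A).PosSemidef :=
  (CFC.sqrt_nonneg A).posSemidef

theorem sqrt_conjTranspose {n : Type*} [Fintype n] [DecidableEq n] (A : Matrix n n ℂ) :
    (CFC.sqrt A)ᴴ = CFC.sqrt A :=
  (sqrt_posSemidef A).isHermitian

/-! ### Polar decomposition and trace inequalities -/

/-- A Hermitian matrix has a commuting Hermitian generalized inverse. -/
theorem exists_hermitian_pseudoinverse {n : Type*} [Fintype n] [DecidableEq n]
    {S : Matrix n n ℂ} (hS : S.IsHermitian) :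
    ∃ T : Matrix n n ℂ, Tᴴ = T ∧ S * T = T * S ∧ S * T * S = S := by
  have hS' : IsSelfAdjoint S := hS
  have hc : ∀ f : ℝ → ℝ, ContinuousOn f (spectrum ℝ S) := fun f =>
    (Matrix.finite_real_spectrum (A := S)).continuousOn f
  -- Since `0⁻¹ = 0` in `ℝ`, inverting the spectrum gives the Moore–Penrose inverse.
  refine ⟨cfc (fun x : ℝ => x⁻¹) S, (cfc_predicate (fun x : ℝ => x⁻¹) S), ?_, ?_⟩
  · exact ((Commute.refl S).cfc_real (fun x : ℝ => x⁻¹)).eq.symm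
  · nth_rw 1 3 [← cfc_id' ℝ S]
    rw [← cfc_mul _ _ S (hc _) (hc _), ← cfc_mul _ _ S (hc _) (hc _)]
    conv_rhs => rw [← cfc_id' ℝ S]
    refine cfc_congr fun x _ => ?_
    by_cases h : x = 0 <;> simp [h]

/-- Left polar decomposition with a partial isometry. -/
theorem exists_polar {a b : Type*} [Fintype a] [DecidableEq a] [Fintype b]
    (G : Matrix a b ℂ) :
    ∃ U : Matrix a b ℂ, CFC.sqrt (G * Gᴴ) * U = G ∧ (1 - U * Uᴴ).PosSemidef ∧
      G * Uᴴ = CFC.sqrt (G * Gᴴ) := by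
  have hH := posSemidef_self_mul_conjTranspose G
  have hSS := sqrt_mul_sqrt hH
  have hSH := sqrt_conjTranspose (G * Gᴴ)
  set S := CFC.sqrt (G * Gᴴ)
  obtain ⟨T, hT, hc, hSTS⟩ := exists_hermitian_pseudoinverse (S := S) hSH
  have hP : T * G * (T * G)ᴴ = S * T := by
    calc T * G * (T * G)ᴴ = T * (G * Gᴴ) * T := by
          rw [conjTranspose_mul, hT]; simp only [Matrix.mul_assoc]
      _ = (T * S) * (S * T) := by rw [← hSS]; simp only [Matrix.mul_assoc]
      _ = S * T := by rw [← hc, ← Matrix.mul_assoc, hSTS]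
  -- `U = T G` satisfies `U Uᴴ = S T`, the projection onto the range of `S`, so no invertibility of
  -- `G Gᴴ` is needed.
  refine ⟨T * G, ?_, ?_, ?_⟩
  · rw [← sub_eq_zero, ← self_mul_conjTranspose_eq_zero]
    have : S * (T * G) - G = (S * T - 1) * G := by
      rw [Matrix.sub_mul, Matrix.one_mul, Matrix.mul_assoc]
    rw [this, conjTranspose_mul, Matrix.mul_assoc, ← Matrix.mul_assoc G, ← hSS,
      ← Matrix.mul_assoc, ← Matrix.mul_assoc]
    have h0 : (S * T - 1) * S = 0 := by rw [Matrix.sub_mul, hSTS, Matrix.one_mul, sub_self]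
    rw [h0]; simp
  · rw [hP]
    have hh : (S * T)ᴴ = S * T := by rw [conjTranspose_mul, hSH, hT, hc]
    have : 1 - S * T = (1 - S * T) * (1 - S * T)ᴴ := by
      rw [conjTranspose_sub, hh, conjTranspose_one, Matrix.sub_mul, Matrix.one_mul,
        Matrix.mul_sub, Matrix.mul_one, ← Matrix.mul_assoc, hSTS, sub_self, sub_zero]
    rw [this]
    exact posSemidef_self_mul_conjTranspose _
  · rw [conjTranspose_mul, hT, ← Matrix.mul_assoc, ← hSS, Matrix.mul_assoc, hc,
      ← Matrix.mul_assoc, hc, ← hc, hSTS]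

/-- Both sides are Schur complements of the block matrix with diagonal blocks `1` and off-diagonal
blocks `U`, `Uᴴ`. -/
theorem posSemidef_one_sub_conjTranspose_mul {a b : Type*} [Fintype a] [DecidableEq a]
    [Fintype b] [DecidableEq b] {U : Matrix a b ℂ} (h : (1 - U * Uᴴ).PosSemidef) :
    (1 - Uᴴ * U).PosSemidef := by
  let := invertibleOne (α := Matrix a a ℂ)
  let := invertibleOne (α := Matrix b b ℂ)
  have := PosDef.fromBlocks₂₂ (1 : Matrix a a ℂ) U (PosDef.one (n := b) (R := ℂ))
  have h2 := PosDef.fromBlocks₁₁ (B := U) (D := (1 : Matrix b b ℂ)) (PosDef.one (n := a) (R := ℂ))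
  simp only [inv_one, Matrix.mul_one] at this h2
  exact h2.1 (this.2 h)

theorem trace_mul_re_nonneg {n : Type*} [Fintype n] [DecidableEq n] {A B : Matrix n n ℂ}
    (hA : A.PosSemidef) (hB : B.PosSemidef) : 0 ≤ (A * B).trace.re := by
  have h : (A * B).trace = (CFC.sqrt A * B * (CFC.sqrt A)ᴴ).trace := by
    rw [sqrt_conjTranspose, trace_mul_comm _ (CFC.sqrt A), ← Matrix.mul_assoc, sqrt_mul_sqrt hA]
  rw [h]
  exact (Complex.le_def.1 (hB.mul_mul_conjTranspose_same _).trace_nonneg).1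

/-- The trace pairing of a positive semidefinite matrix with the product of two contractions is
at most its trace. -/
theorem trace_contraction_mul_re_le {a b : Type*} [Fintype a] [DecidableEq a] [Fintype b]
    {S : Matrix a a ℂ} (hS : S.PosSemidef) {X Y : Matrix a b ℂ}
    (hX : (1 - X * Xᴴ).PosSemidef) (hY : (1 - Y * Yᴴ).PosSemidef) :
    (X * Yᴴ * S).trace.re ≤ S.trace.re := by
  have h1 := trace_mul_re_nonneg hX hS
  have h2 := trace_mul_re_nonneg hY hS
  -- Expanding `(X - Y) (X - Y)ᴴ` against `S` bounds the cross term by the mean of the two squares,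
  -- each at most `Tr S`.
  have h3 := trace_mul_re_nonneg (posSemidef_self_mul_conjTranspose (X - Y)) hS
  have h4 : (Y * Xᴴ * S).trace.re = (X * Yᴴ * S).trace.re := by
    have : (Y * Xᴴ * S).trace = star (X * Yᴴ * S).trace := by
      rw [← trace_conjTranspose, conjTranspose_mul, conjTranspose_mul, conjTranspose_conjTranspose,
        hS.isHermitian.eq, trace_mul_comm]
    rw [this]; simp
  rw [Matrix.sub_mul, trace_sub, Complex.sub_re, Matrix.one_mul] at h1 h2
  rw [conjTranspose_sub, Matrix.sub_mul, Matrix.mul_sub, Matrix.mul_sub] at h3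
  simp only [Matrix.sub_mul, trace_sub, Complex.sub_re, h4] at h3
  linarith

/-! ### Uhlmann's theorem and the fidelity of states -/

/-- The square root `‖√ρ √σ‖₁` of the fidelity. -/
def rootFidelity {n : Type*} [Fintype n] [DecidableEq n] (ρ σ : Matrix n n ℂ) : ℝ :=
  traceNorm (CFC.sqrt ρ * CFC.sqrt σ)

theorem stateFidelity_eq {n : Type*} [Fintype n] [DecidableEq n] (ρ σ : Matrix n n ℂ) :
    stateFidelity ρ σ = rootFidelity ρ σ ^ 2 := rfl

theorem rootFidelity_nonneg {n : Type*} [Fintype n] [DecidableEq n] (ρ σ : Matrix n n ℂ) :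
    0 ≤ rootFidelity ρ σ :=
  (Complex.le_def.1 (sqrt_posSemidef _).trace_nonneg).1

/-- Half of Uhlmann's theorem: the overlap of any two purifications is at most the root
fidelity. -/
theorem trace_re_le_rootFidelity {a b : Type*} [Fintype a] [DecidableEq a] [Fintype b]
    (X Y : Matrix a b ℂ) :
    (X * Yᴴ).trace.re ≤ rootFidelity (X * Xᴴ) (Y * Yᴴ) := by
  obtain ⟨U, hU, hU1, -⟩ := exists_polar X
  obtain ⟨V, hV, hV1, -⟩ := exists_polar Y
  have hr := sqrt_conjTranspose (X * Xᴴ)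
  have hs := sqrt_conjTranspose (Y * Yᴴ)
  unfold rootFidelity traceNorm
  set r := CFC.sqrt (X * Xᴴ)
  set s := CFC.sqrt (Y * Yᴴ)
  obtain ⟨W, hW, hW1, -⟩ := exists_polar (r * s)ᴴ
  rw [conjTranspose_conjTranspose] at hW
  have hS := sqrt_posSemidef ((r * s)ᴴ * (r * s))
  set S := CFC.sqrt ((r * s)ᴴ * (r * s))
  have key : (X * Yᴴ).trace = ((W * U) * Vᴴ * S).trace := by
    calc (X * Yᴴ).trace = (r * (U * Vᴴ) * s).trace := by
          rw [← hU, ← hV, conjTranspose_mul, hs]; simp only [Matrix.mul_assoc]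
      _ = (U * Vᴴ * (S * W)).trace := by
          rw [hW, conjTranspose_mul, hr, hs, Matrix.mul_assoc, trace_mul_comm]
          simp only [Matrix.mul_assoc]
      _ = _ := by
          rw [← Matrix.mul_assoc, trace_mul_comm]; simp only [Matrix.mul_assoc]
  rw [key]
  refine trace_contraction_mul_re_le hS ?_ hV1
  have : 1 - W * U * (W * U)ᴴ = (1 - W * Wᴴ) + W * (1 - U * Uᴴ) * Wᴴ := by
    rw [conjTranspose_mul, Matrix.mul_sub, Matrix.sub_mul, Matrix.mul_one]
    simp only [Matrix.mul_assoc]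
    abel
  rw [this]
  exact hW1.add (hU1.mul_mul_conjTranspose_same W)

/-- The reference purification of a state. -/
def purify {a : Type*} [Fintype a] [DecidableEq a] (σ : Matrix a a ℂ) : Matrix a (a ⊕ a) ℂ :=
  fromCols (CFC.sqrt σ) 0

theorem purify_mul_conjTranspose {a : Type*} [Fintype a] [DecidableEq a] {σ : Matrix a a ℂ}
    (hσ : σ.PosSemidef) : purify σ * (purify σ)ᴴ = σ := by
  rw [purify, conjTranspose_fromCols_eq_fromRows_conjTranspose, fromCols_mul_fromRows,
    sqrt_conjTranspose, sqrt_mul_sqrt hσ]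
  simp

/-- The other half of Uhlmann's theorem: the root fidelity is the overlap of the reference
purification of `σ` with some purification of `ρ`. -/
theorem exists_purification {a : Type*} [Fintype a] [DecidableEq a] {ρ : Matrix a a ℂ}
    (hρ : ρ.PosSemidef) (σ : Matrix a a ℂ) :
    ∃ A : Matrix a (a ⊕ a) ℂ, A * Aᴴ = ρ ∧
      (A * (purify σ)ᴴ).trace = (rootFidelity ρ σ : ℂ) := by
  have hr := sqrt_conjTranspose ρ
  have hs := sqrt_conjTranspose σ
  have hrr := sqrt_mul_sqrt hρ
  unfold rootFidelity traceNorm purify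
  set r := CFC.sqrt ρ
  set s := CFC.sqrt σ
  obtain ⟨U, -, hU1, hU⟩ := exists_polar (r * s)ᴴ
  rw [conjTranspose_conjTranspose] at hU
  have hS := sqrt_posSemidef ((r * s)ᴴ * (r * s))
  set S := CFC.sqrt ((r * s)ᴴ * (r * s))
  have hD := posSemidef_one_sub_conjTranspose_mul hU1
  have hdd := sqrt_mul_sqrt hD
  have hd := sqrt_conjTranspose (1 - Uᴴ * U)
  set d := CFC.sqrt (1 - Uᴴ * U)
  -- The first block attains the overlap but is only a contraction of `r`. The block with the defect
  -- operator `d` restores `A Aᴴ = ρ` and meets the zero block of `purify σ`.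
  refine ⟨fromCols (r * Uᴴ) (r * d), ?_, ?_⟩
  · rw [conjTranspose_fromCols_eq_fromRows_conjTranspose, fromCols_mul_fromRows]
    have : r * Uᴴ * (r * Uᴴ)ᴴ + r * d * (r * d)ᴴ = r * (Uᴴ * U + d * d) * r := by
      rw [conjTranspose_mul, conjTranspose_mul, conjTranspose_conjTranspose, hr, hd]
      simp only [Matrix.mul_assoc, Matrix.mul_add, Matrix.add_mul]
    rw [this, hdd, add_sub_cancel, Matrix.mul_one, hrr]
  · rw [conjTranspose_fromCols_eq_fromRows_conjTranspose, fromCols_mul_fromRows, hs,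
      conjTranspose_zero, Matrix.mul_zero, add_zero, trace_mul_comm, ← Matrix.mul_assoc]
    have : s * r = (r * s)ᴴ := by rw [conjTranspose_mul, hr, hs]
    rw [this, hU]
    have h0 := hS.trace_nonneg
    exact Complex.ext rfl (by simpa using (Complex.le_def.1 h0).2.symm)

theorem trace_mul_conjTranspose_re_comm {a b : Type*} [Fintype a] [Fintype b]
    (X Y : Matrix a b ℂ) : (X * Yᴴ).trace.re = (Y * Xᴴ).trace.re := by
  have : (Y * Xᴴ).trace = star (X * Yᴴ).trace := by
    rw [← trace_conjTranspose, conjTranspose_mul, conjTranspose_conjTranspose]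
  rw [this]; simp

theorem rootFidelity_comm_le {a : Type*} [Fintype a] [DecidableEq a] {ρ σ : Matrix a a ℂ}
    (hρ : ρ.PosSemidef) (hσ : σ.PosSemidef) : rootFidelity ρ σ ≤ rootFidelity σ ρ := by
  obtain ⟨A, hA, hA'⟩ := exists_purification hρ σ
  have h := trace_re_le_rootFidelity (purify σ) A
  rwa [hA, purify_mul_conjTranspose hσ, trace_mul_conjTranspose_re_comm, hA',
    Complex.ofReal_re] at h

theorem rootFidelity_comm {a : Type*} [Fintype a] [DecidableEq a] {ρ σ : Matrix a a ℂ}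
    (hρ : ρ.PosSemidef) (hσ : σ.PosSemidef) : rootFidelity ρ σ = rootFidelity σ ρ :=
  le_antisymm (rootFidelity_comm_le hρ hσ) (rootFidelity_comm_le hσ hρ)

/-- The matrix as a vector of the Hilbert–Schmidt space. -/
def toHS {a b : Type*} [Fintype a] [Fintype b] (X : Matrix a b ℂ) : EuclideanSpace ℂ (a × b) :=
  WithLp.toLp 2 fun p => X p.1 p.2

/-- Turns overlaps of purifications into Hilbert-space distances, where the ordinary triangle
inequality applies. -/
theorem norm_toHS_sub_sq {a b : Type*} [Fintype a] [Fintype b] (X Y : Matrix a b ℂ) :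
    ‖toHS X - toHS Y‖ ^ 2 =
      (X * Xᴴ).trace.re + (Y * Yᴴ).trace.re - 2 * (X * Yᴴ).trace.re := by
  have h : ∀ Z : Matrix a b ℂ, ‖toHS Z‖ ^ 2 = (Z * Zᴴ).trace.re := by
    intro Z
    rw [EuclideanSpace.norm_sq_eq, Fintype.sum_prod_type]
    simp only [toHS, trace, diag, Matrix.mul_apply, conjTranspose_apply, Complex.re_sum]
    refine Finset.sum_congr rfl fun i _ => Finset.sum_congr rfl fun j _ => ?_
    rw [← Complex.normSq_eq_norm_sq, Complex.normSq_apply]; simp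
  have h1 : toHS X - toHS Y = toHS (X - Y) := by ext p; simp [toHS]
  rw [h1, h, conjTranspose_sub, Matrix.sub_mul, Matrix.mul_sub, Matrix.mul_sub]
  simp only [trace_sub, Complex.sub_re, trace_mul_conjTranspose_re_comm Y X]
  ring

/-- A triangle inequality for the fidelity of states. -/
theorem stateFidelity_triangle {a : Type*} [Fintype a] [DecidableEq a] {ρ σ τ : Matrix a a ℂ}
    (hρ : IsState ρ) (hσ : IsState σ) (hτ : IsState τ) {δ ε : ℝ} (hδ : 0 ≤ δ) (hε : 0 ≤ ε)
    (h₁ : 1 - δ ≤ stateFidelity ρ σ) (h₂ : 1 - ε ≤ stateFidelity σ τ) :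
    1 - 2 * (Real.sqrt δ + Real.sqrt ε) ≤ stateFidelity ρ τ := by
  have hn := rootFidelity_nonneg ρ τ
  rw [stateFidelity_eq] at h₁ h₂ ⊢
  -- Beyond this threshold the claimed lower bound is negative.
  by_cases hs : 1 < Real.sqrt δ + Real.sqrt ε
  · nlinarith [sq_nonneg (rootFidelity ρ τ)]
  rw [rootFidelity_comm hσ.1 hτ.1] at h₂
  obtain ⟨A, hA, hA'⟩ := exists_purification hρ.1 σ
  obtain ⟨C, hC, hC'⟩ := exists_purification hτ.1 σ
  have h := trace_re_le_rootFidelity A C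
  rw [hA, hC] at h
  have hAB := norm_toHS_sub_sq A (purify σ)
  have hCB := norm_toHS_sub_sq C (purify σ)
  have hAC := norm_toHS_sub_sq A C
  rw [purify_mul_conjTranspose hσ.1] at hAB hCB
  rw [hA, hA', hρ.2, hσ.2] at hAB
  rw [hC, hC', hτ.2, hσ.2] at hCB
  rw [hA, hC, hρ.2, hτ.2] at hAC
  simp only [Complex.one_re, Complex.ofReal_re] at hAB hCB hAC
  have htri : ‖toHS A - toHS C‖ ≤ ‖toHS A - toHS (purify σ)‖ + ‖toHS C - toHS (purify σ)‖ := by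
    rw [norm_sub_rev (toHS C)]; exact norm_sub_le_norm_sub_add_norm_sub _ _ _
  have hx := norm_nonneg (toHS A - toHS (purify σ))
  have hy := norm_nonneg (toHS C - toHS (purify σ))
  have hz := norm_nonneg (toHS A - toHS C)
  set x := ‖toHS A - toHS (purify σ)‖
  set y := ‖toHS C - toHS (purify σ)‖
  set z := ‖toHS A - toHS C‖
  have bound : ∀ {f e w : ℝ}, 0 ≤ f → 0 ≤ e → 1 - e ≤ f ^ 2 → w ^ 2 = 1 + 1 - 2 * f →
      w ^ 2 ≤ 2 * e := by
    intro f e w hf he hfe hw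
    have hf1 : f ≤ 1 := by nlinarith [sq_nonneg w]
    nlinarith [mul_nonneg hf (sub_nonneg.2 hf1)]
  have bx : x ≤ Real.sqrt 2 * Real.sqrt δ := by
    rw [← Real.sqrt_mul (by norm_num)]
    exact Real.le_sqrt_of_sq_le (bound (rootFidelity_nonneg _ _) hδ h₁ hAB)
  have byy : y ≤ Real.sqrt 2 * Real.sqrt ε := by
    rw [← Real.sqrt_mul (by norm_num)]
    exact Real.le_sqrt_of_sq_le (bound (rootFidelity_nonneg _ _) hε h₂ hCB)
  have hz2 : z ≤ Real.sqrt 2 * (Real.sqrt δ + Real.sqrt ε) := by linarith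
  have h2 : Real.sqrt 2 ^ 2 = 2 := Real.sq_sqrt (by norm_num)
  have hss : 0 ≤ Real.sqrt δ + Real.sqrt ε := by positivity
  set s := Real.sqrt δ + Real.sqrt ε
  have hz3 : z ^ 2 ≤ 2 * s ^ 2 := by
    calc z ^ 2 ≤ (Real.sqrt 2 * s) ^ 2 := by gcongr
      _ = 2 * s ^ 2 := by rw [mul_pow, h2]
  -- Squaring this gives at least `1 - 2 * s ^ 2`, and `s ^ 2 ≤ s` because `s ≤ 1`.
  have h5 : 1 - s ^ 2 ≤ rootFidelity ρ τ := by linarith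
  push Not at hs
  nlinarith [mul_nonneg hss (sub_nonneg.2 hs)]

/-! ### Channels, arbitrary finite ancillas and monotonicity of the fidelity -/

theorem IsChannel.posSemidef_idTensor {n m : Type*} [Fintype n] [Fintype m] {Φ : SuperOp n m}
    (hΦ : IsChannel Φ) {k : Type*} [Fintype k] {X : Matrix (k × n) (k × n) ℂ}
    (hX : X.PosSemidef) : (idTensor k Φ X).PosSemidef := by
  let e := Fintype.equivFin k
  have h := hΦ.completelyPositive _ _ (hX.submatrix (Prod.map e.symm id))
  have h2 := h.submatrix (Prod.map e id)
  convert! h2 using 1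
  ext p q
  simp [idTensor]

theorem trace_idTensor {n m : Type*} [Fintype n] [Fintype m] {Φ : SuperOp n m}
    (hΦ : IsChannel Φ) {k : Type*} [Fintype k] (X : Matrix (k × n) (k × n) ℂ) :
    (idTensor k Φ X).trace = X.trace := by
  simp only [trace, diag, Fintype.sum_prod_type]
  refine Finset.sum_congr rfl fun i _ => ?_
  exact hΦ.tracePreserving (Matrix.of fun a b => X (i, a) (i, b))

theorem IsChannel.idTensor {n m : Type*} [Fintype n] [Fintype m] {Φ : SuperOp n m}
    (hΦ : IsChannel Φ) (k : Type*) [Fintype k] : IsChannel (idTensor k Φ) where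
  completelyPositive j _ hX :=
    (hΦ.posSemidef_idTensor (k := Fin j × k)
      (hX.submatrix (Equiv.prodAssoc (Fin j) k n))).submatrix (Equiv.prodAssoc (Fin j) k m).symm
  tracePreserving := trace_idTensor hΦ

theorem IsChannel.posSemidef {n m : Type*} [Fintype n] [Fintype m] {Φ : SuperOp n m}
    (hΦ : IsChannel Φ) {X : Matrix n n ℂ} (hX : X.PosSemidef) : (Φ X).PosSemidef :=
  (hΦ.posSemidef_idTensor (k := Unit)
    (hX.submatrix (Prod.snd : Unit × n → n))).submatrix (fun a => ((), a))

theorem IsChannel.isState {n m : Type*} [Fintype n] [Fintype m] {Φ : SuperOp n m}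
    (hΦ : IsChannel Φ) {ρ : Matrix n n ℂ} (hρ : IsState ρ) : IsState (Φ ρ) :=
  ⟨hΦ.posSemidef hρ.1, (hΦ.tracePreserving ρ).trans hρ.2⟩

/-- The fidelity does not decrease under channels. -/
theorem rootFidelity_le_map {n m : Type*} [Fintype n] [DecidableEq n] [Fintype m] [DecidableEq m]
    {Φ : SuperOp n m} (hΦ : IsChannel Φ) {ρ σ : Matrix n n ℂ} (hρ : ρ.PosSemidef)
    (hσ : σ.PosSemidef) : rootFidelity ρ σ ≤ rootFidelity (Φ ρ) (Φ σ) := by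
  obtain ⟨A, hA, hA'⟩ := exists_purification hρ σ
  -- Stacking the two purifications makes their overlap an off-diagonal block of `G Gᴴ`. Complete
  -- positivity with a two-level ancilla keeps the block matrix positive, and trace preservation
  -- keeps the overlap.
  let G : Matrix (Fin 2 × n) (n ⊕ n) ℂ := Matrix.of fun p c => ![A, purify σ] p.1 p.2 c
  have hG := (posSemidef_self_mul_conjTranspose G)
  have hΦG := hΦ.posSemidef_idTensor hG
  have hSS := sqrt_mul_sqrt hΦG
  have hS := sqrt_conjTranspose (ChannelResource.idTensor (Fin 2) Φ (G * Gᴴ))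
  set S := CFC.sqrt (ChannelResource.idTensor (Fin 2) Φ (G * Gᴴ))
  have hblock : ∀ i j : Fin 2, S.submatrix (fun a => (i, a)) id *
      (S.submatrix (fun a => (j, a)) id)ᴴ = Φ (![A, purify σ] i * (![A, purify σ] j)ᴴ) := by
    intro i j
    have : S.submatrix (fun a => (i, a)) id * (S.submatrix (fun a => (j, a)) id)ᴴ =
        (S * Sᴴ).submatrix (fun a => (i, a)) (fun a => (j, a)) := by
      ext a b; simp [Matrix.mul_apply]
    rw [this, hS, hSS]
    rfl
  have h := trace_re_le_rootFidelity (S.submatrix (fun a => ((0 : Fin 2), a)) id)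
    (S.submatrix (fun a => ((1 : Fin 2), a)) id)
  rw [hblock, hblock, hblock, hΦ.tracePreserving] at h
  simpa [hA, hA', purify_mul_conjTranspose hσ] using h

/-- Purify `t ρ + ω` by placing `√t A` next to `√ω`; the second block is orthogonal to the
purification of `σ`, so the overlap only picks up `√t`. -/
theorem mul_stateFidelity_le_add {a : Type*} [Fintype a] [DecidableEq a] {ρ σ ω : Matrix a a ℂ}
    (hρ : ρ.PosSemidef) (hσ : σ.PosSemidef) (hω : ω.PosSemidef) {t : ℝ} (ht : 0 ≤ t) :
    t * stateFidelity ρ σ ≤ stateFidelity ((t : ℂ) • ρ + ω) σ := by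
  obtain ⟨A, hA, hA'⟩ := exists_purification hρ σ
  have h := trace_re_le_rootFidelity (fromCols ((Real.sqrt t : ℂ) • A) (CFC.sqrt ω))
    (fromCols (purify σ) 0)
  simp only [conjTranspose_fromCols_eq_fromRows_conjTranspose, fromCols_mul_fromRows,
    conjTranspose_smul, conjTranspose_zero, Matrix.mul_zero, add_zero, Matrix.smul_mul,
    Matrix.mul_smul, smul_smul, sqrt_conjTranspose, sqrt_mul_sqrt hω, hA,
    purify_mul_conjTranspose hσ, trace_smul, hA'] at h
  have h2 : (Real.sqrt t : ℂ) * star (Real.sqrt t : ℂ) = (t : ℂ) := by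
    have h3 : (Real.sqrt t : ℂ) * (Real.sqrt t : ℂ) = (t : ℂ) := by
      rw [← Complex.ofReal_mul, Real.mul_self_sqrt ht]
    simpa using h3
  rw [mul_comm] at h2
  have h4 : ((Real.sqrt t : ℂ) • (rootFidelity ρ σ : ℂ)).re = Real.sqrt t * rootFidelity ρ σ := by
    simp
  rw [h4] at h
  rw [mul_comm (star _), mul_comm] at h2
  simp only [h2] at h
  rw [stateFidelity_eq, stateFidelity_eq, ← Real.sq_sqrt ht, ← mul_pow, Real.sq_sqrt ht]
  have := mul_nonneg (Real.sqrt_nonneg t) (rootFidelity_nonneg ρ σ)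
  gcongr

theorem exists_isState (n : Type*) [Fintype n] [Nonempty n] : ∃ ρ : Matrix n n ℂ, IsState ρ := by
  classical
  obtain ⟨i⟩ := ‹Nonempty n›
  refine ⟨Matrix.diagonal (Pi.single i 1), ?_, by simp [trace_diagonal]⟩
  exact PosSemidef.diagonal (Pi.single_nonneg.2 zero_le_one)

/-- Nonemptiness of `n` provides an input state, so the real infimum is not the default value `0` of
an empty set. -/
theorem le_channelFidelity_iff {n m : Type*} [Fintype n] [Nonempty n] [Fintype m] [DecidableEq m]
    {Φ Ψ : SuperOp n m} {c : ℝ} :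
    c ≤ channelFidelity Φ Ψ ↔ ∀ (k : ℕ) (ρ : Matrix (Fin k × n) (Fin k × n) ℂ), IsState ρ →
      c ≤ stateFidelity (idTensor (Fin k) Φ ρ) (idTensor (Fin k) Ψ ρ) := by
  unfold channelFidelity
  constructor
  · intro h k ρ hρ
    refine h.trans (csInf_le ⟨0, ?_⟩ ⟨k, ρ, hρ, rfl⟩)
    rintro f ⟨k, ρ, -, rfl⟩
    exact sq_nonneg _
  · intro h
    obtain ⟨ρ, hρ⟩ := exists_isState (Fin 1 × n)
    refine le_csInf ⟨_, 1, ρ, hρ, rfl⟩ ?_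
    rintro f ⟨k, ρ, hρ, rfl⟩
    exact h k ρ hρ

theorem stateFidelity_reindex {a b : Type*} [Fintype a] [DecidableEq a] [Fintype b]
    [DecidableEq b] (e : a ≃ b) {ρ σ : Matrix b b ℂ} (hρ : ρ.PosSemidef) (hσ : σ.PosSemidef) :
    stateFidelity ρ σ ≤ stateFidelity (ρ.submatrix e e) (σ.submatrix e e) := by
  obtain ⟨A, hA, hA'⟩ := exists_purification hρ σ
  have h := trace_re_le_rootFidelity (A.submatrix e id) ((purify σ).submatrix e id)
  have h1 : ∀ X Y : Matrix b (b ⊕ b) ℂ, X.submatrix e id * (Y.submatrix e id)ᴴ =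
      (X * Yᴴ).submatrix e e := fun X Y => by ext; simp [Matrix.mul_apply]
  have h2 : ((A * (purify σ)ᴴ).submatrix e e).trace = (A * (purify σ)ᴴ).trace := by
    simp only [trace, diag, submatrix_apply]
    exact Equiv.sum_comp e (fun i => (A * (purify σ)ᴴ) i i)
  rw [h1, h1, h1, hA, purify_mul_conjTranspose hσ, h2, hA', Complex.ofReal_re] at h
  exact pow_le_pow_left₀ (rootFidelity_nonneg _ _) h 2

/-- The worst-case fidelity bounds the fidelity for an ancilla that is an arbitrary finite type. -/
theorem le_stateFidelity_of_le_channelFidelity {n m : Type*} [Fintype n] [Nonempty n] [Fintype m]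
    [DecidableEq m] {Φ Ψ : SuperOp n m} (hΦ : IsChannel Φ) (hΨ : IsChannel Ψ) {c : ℝ}
    (h : c ≤ channelFidelity Φ Ψ) {k : Type*} [Fintype k] [DecidableEq k]
    {ρ : Matrix (k × n) (k × n) ℂ} (hρ : IsState ρ) :
    c ≤ stateFidelity (idTensor k Φ ρ) (idTensor k Ψ ρ) := by
  let e := Fintype.equivFin k
  let ρ' := ρ.submatrix (Prod.map e.symm id) (Prod.map e.symm id)
  have hρ' : IsState ρ' := by
    refine ⟨hρ.1.submatrix _, ?_⟩
    rw [← hρ.2]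
    exact Equiv.sum_comp (e.symm.prodCongr (Equiv.refl n)) (fun i => ρ i i)
  refine (le_channelFidelity_iff.1 h _ ρ' hρ').trans ?_
  refine (stateFidelity_reindex (e.prodCongr (Equiv.refl m))
    ((hΦ.idTensor _).isState hρ').1 ((hΨ.idTensor _).isState hρ').1).trans (le_of_eq ?_)
  congr 1 <;>
  · ext p q
    simp [idTensor, ρ']

/-- `pre` only yields another input state, the memory joins the ancilla, and `post` is a channel,
under which fidelity cannot decrease. -/
theorem IsSuperchannel.le_channelFidelity {n m n' m' : Type*} [Fintype n] [Nonempty n] [Fintype m]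
    [DecidableEq m] [Fintype n'] [Nonempty n'] [Fintype m'] [DecidableEq m']
    {Θ : SuperOp n m → SuperOp n' m'} (hΘ : IsSuperchannel Θ) {Φ Ψ : SuperOp n m}
    (hΦ : IsChannel Φ) (hΨ : IsChannel Ψ) {c : ℝ} (h : c ≤ channelFidelity Φ Ψ) :
    c ≤ channelFidelity (Θ Φ) (Θ Ψ) := by
  obtain ⟨k, pre, post, hpre, hpost, hΘ⟩ := hΘ
  rw [le_channelFidelity_iff]
  intro j ρ hρ
  have hτ := (hpre.idTensor (Fin j)).isState hρ
  set τ := idTensor (Fin j) pre ρ with hτd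
  have hout : ∀ L : SuperOp n m, idTensor (Fin j) (Θ L) ρ =
      idTensor (Fin j) post (idTensor (Fin j) (idTensor (Fin k) L) τ) := fun L => by
    rw [hΘ L]; rfl
  rw [hout, hout]
  have h1 := ((hΦ.idTensor (Fin k)).idTensor (Fin j)).isState hτ
  have h2 := ((hΨ.idTensor (Fin k)).idTensor (Fin j)).isState hτ
  refine le_trans ?_ (pow_le_pow_left₀ (rootFidelity_nonneg _ _)
    (rootFidelity_le_map (hpost.idTensor (Fin j)) h1.1 h2.1) 2)
  let τ' := τ.submatrix (Equiv.prodAssoc (Fin j) (Fin k) n) (Equiv.prodAssoc (Fin j) (Fin k) n)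
  have hτ' : IsState τ' := by
    refine ⟨hτ.1.submatrix _, ?_⟩
    rw [← hτ.2]
    exact Equiv.sum_comp (Equiv.prodAssoc (Fin j) (Fin k) n) (fun i => τ i i)
  refine (le_stateFidelity_of_le_channelFidelity hΦ hΨ h hτ').trans ?_
  exact stateFidelity_reindex (Equiv.prodAssoc (Fin j) (Fin k) m).symm
    ((hΦ.idTensor _).isState hτ').1 ((hΨ.idTensor _).isState hτ').1

/-! ### Necessary conditions for a conversion -/

/-- The necessary conditions for a conversion, for arbitrary resource monotones. -/
theorem smooth_le_of_conversion {n m n' m' : Type*} [Fintype n] [Nonempty n] [Fintype m]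
    [DecidableEq m] [Fintype n'] [Nonempty n'] [Fintype m'] [DecidableEq m']
    {T : ResourceTheory n m} {T' : ResourceTheory n' m'} {E : SuperOp n m} (hE : E ∈ T.allowed)
    {N : SuperOp n' m'} (hN : N ∈ T'.allowed) {ε : ℝ} (hε : 0 ≤ ε)
    {Θ : SuperOp n m → SuperOp n' m'} (hΘ : Θ ∈ freeSuperchannels T T')
    (hF : 1 - ε ≤ channelFidelity (Θ E) N) {R : SuperOp n m → EReal} {R' : SuperOp n' m' → EReal}
    (hR : IsMonotone T T' R R') :
    smooth T' R' ε N ≤ R E ∧ ∀ δ : ℝ, 0 ≤ δ →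
      smooth T' R' (2 * (Real.sqrt δ + Real.sqrt ε)) N ≤ smooth T R δ E := by
  have hle : ∀ (c : ℝ) (L : SuperOp n' m'), L ∈ T'.allowed → 1 - c ≤ channelFidelity L N →
      smooth T' R' c N ≤ R' L := fun c L hL hc => sInf_le ⟨L, hL, hc, rfl⟩
  refine ⟨(hle ε (Θ E) (hΘ.2.1 E hE) hF).trans (hR Θ hΘ E hE), fun δ hδ => ?_⟩
  refine le_sInf ?_
  rintro v ⟨L, hL, hLE, rfl⟩
  refine (hle _ (Θ L) (hΘ.2.1 L hL) ?_).trans (hR Θ hΘ L hL)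
  have h1 := hΘ.1.le_channelFidelity (T.allowed_isChannel L hL) (T.allowed_isChannel E hE) hLE
  rw [le_channelFidelity_iff] at h1 hF ⊢
  intro k ρ hρ
  exact stateFidelity_triangle
    (((T'.allowed_isChannel _ (hΘ.2.1 L hL)).idTensor _).isState hρ)
    (((T'.allowed_isChannel _ (hΘ.2.1 E hE)).idTensor _).isState hρ)
    (((T'.allowed_isChannel _ hN).idTensor _).isState hρ) hδ hε (h1 k ρ hρ) (hF k ρ hρ)

/-! ### Measure-and-prepare superchannels -/

theorem IsChannel.comp {a b c : Type*} [Fintype a] [Fintype b] [Fintype c] {Φ : SuperOp b c}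
    {Ψ : SuperOp a b} (hΦ : IsChannel Φ) (hΨ : IsChannel Ψ) : IsChannel (Φ ∘ₗ Ψ) where
  completelyPositive k X hX :=
    hΦ.completelyPositive k _ (hΨ.completelyPositive k X hX)
  tracePreserving X := (hΦ.tracePreserving _).trans (hΨ.tracePreserving X)

/-- Relabelling of the basis vectors. -/
def relabel {a b : Type*} [Fintype a] [Fintype b] (e : a ≃ b) : SuperOp a b where
  toFun X := X.submatrix e.symm e.symm
  map_add' _ _ := rfl
  map_smul' _ _ := rfl

theorem isChannel_relabel {a b : Type*} [Fintype a] [Fintype b] (e : a ≃ b) :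
    IsChannel (relabel e) where
  completelyPositive _ _ hX := hX.submatrix (Prod.map id e.symm)
  tracePreserving X := Equiv.sum_comp e.symm (fun i => X i i)

theorem isSuperchannel_of_memory {n m n' m' κ : Type*} [Fintype n] [Fintype m] [Fintype n']
    [Fintype m'] [Fintype κ] {pre : SuperOp n' (κ × n)} {post : SuperOp (κ × m) m'}
    (hpre : IsChannel pre) (hpost : IsChannel post) :
    IsSuperchannel fun L : SuperOp n m => post ∘ₗ idTensor κ L ∘ₗ pre := by
  let e := Fintype.equivFin κ
  refine ⟨Fintype.card κ, relabel (e.prodCongr (Equiv.refl n)) ∘ₗ pre,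
    post ∘ₗ relabel (e.symm.prodCongr (Equiv.refl m)), (isChannel_relabel _).comp hpre,
    hpost.comp (isChannel_relabel _), fun L => ?_⟩
  ext1 X
  simp only [LinearMap.comp_apply]
  congr 1
  ext p q
  simp [relabel, idTensor]

/-- The map that appends a system in the state `ω`. -/
def append {v : Type*} [Fintype v] (u : Type*) [Fintype u] (ω : Matrix v v ℂ) :
    SuperOp u (u × v) where
  toFun X := X ⊗ₖ ω
  map_add' X Y := add_kronecker X Y ω
  map_smul' c X := smul_kronecker c X ω

theorem isChannel_append {u v : Type*} [Fintype u] [Fintype v] {ω : Matrix v v ℂ}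
    (hω : IsState ω) : IsChannel (append u ω) where
  completelyPositive k X hX :=
    (hX.kronecker hω.1).submatrix (Equiv.prodAssoc (Fin k) u v).symm
  tracePreserving X := (trace_kronecker X ω).trans (by rw [hω.2, mul_one])

/-- The pairing of the second tensor factor with `P`, that is, `Y ↦ Tr₂ ((1 ⊗ P) Y)`. -/
def pairing {v : Type*} [Fintype v] (u : Type*) [Fintype u] (P : Matrix v v ℂ) :
    SuperOp (u × v) u where
  toFun Y := Matrix.of fun x y => ∑ p, ∑ q, P q p * Y (x, p) (y, q)
  map_add' X Y := by ext; simp [mul_add, Finset.sum_add_distrib]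
  map_smul' c X := by ext; simp [Finset.mul_sum, mul_left_comm]

/-- Factoring `P` and `Y` through their square roots exhibits the partial trace as a Gram matrix `B
Bᴴ`. -/
theorem pairing_posSemidef {u v : Type*} [Fintype u] [Fintype v] {P : Matrix v v ℂ}
    (hP : P.PosSemidef) {Y : Matrix (u × v) (u × v) ℂ} (hY : Y.PosSemidef) :
    (pairing u P Y).PosSemidef := by
  classical
  have hPP := sqrt_mul_sqrt hP
  have hPs := sqrt_conjTranspose P
  have hYY := sqrt_mul_sqrt hY
  have hYs := sqrt_conjTranspose Y
  set R := CFC.sqrt P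
  set S := CFC.sqrt Y
  let B : Matrix u (v × (u × v)) ℂ :=
    Matrix.of fun x c => ∑ p, star (R p c.1) * S (x, p) c.2
  have : pairing u P Y = B * Bᴴ := by
    ext x y
    have h1 : ∀ p q, P q p = ∑ c, R q c * star (R p c) := fun p q => by
      rw [← hPP]; nth_rw 2 [← hPs]; rfl
    have h2 : ∀ p q, Y p q = ∑ d, S p d * star (S q d) := fun p q => by
      rw [← hYY]; nth_rw 2 [← hYs]; rfl
    simp only [pairing, LinearMap.coe_mk, AddHom.coe_mk, of_apply, Matrix.mul_apply,
      conjTranspose_apply, B, star_sum, star_mul', star_star, h1, h2, Finset.sum_mul_sum]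
    calc _ = ∑ p, ∑ c, ∑ d, ∑ q, (R q c * star (R p c)) * (S (x, p) d * star (S (y, q) d)) := by
          refine Finset.sum_congr rfl fun p _ => ?_
          rw [Finset.sum_comm]
          refine Finset.sum_congr rfl fun c _ => ?_
          rw [Finset.sum_comm]
      _ = ∑ c, ∑ d, ∑ p, ∑ q, (R q c * star (R p c)) * (S (x, p) d * star (S (y, q) d)) := by
          rw [Finset.sum_comm]
          exact Finset.sum_congr rfl fun c _ => Finset.sum_comm
      _ = _ := by
          rw [Fintype.sum_prod_type]
          refine Finset.sum_congr rfl fun c _ => Finset.sum_congr rfl fun d _ =>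
            Finset.sum_congr rfl fun p _ => Finset.sum_congr rfl fun q _ => ?_
          ring
  rw [this]
  exact posSemidef_self_mul_conjTranspose B

theorem pairing_completelyPositive {u v : Type*} [Fintype u] [Fintype v] {P : Matrix v v ℂ}
    (hP : P.PosSemidef) (k : ℕ) (X : Matrix (Fin k × (u × v)) (Fin k × (u × v)) ℂ)
    (hX : X.PosSemidef) : (idTensor (Fin k) (pairing u P) X).PosSemidef := by
  have h := pairing_posSemidef hP (hX.submatrix (Equiv.prodAssoc (Fin k) u v))
  have h2 : pairing (Fin k × u) P (X.submatrix (Equiv.prodAssoc (Fin k) u v)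
      (Equiv.prodAssoc (Fin k) u v)) = idTensor (Fin k) (pairing u P) X := by
    ext p q
    simp [pairing, idTensor]
  rwa [h2] at h

theorem trace_pairing_add {u v : Type*} [Fintype u] [Fintype v] [DecidableEq v]
    (P : Matrix v v ℂ) (Y : Matrix (u × v) (u × v) ℂ) :
    (pairing u P Y).trace + (pairing u (1 - P) Y).trace = Y.trace := by
  rw [← trace_add]
  simp only [trace, diag, pairing, LinearMap.coe_mk, AddHom.coe_mk, Matrix.add_apply, of_apply,
    Fintype.sum_prod_type, ← Finset.sum_add_distrib, ← add_mul, Matrix.sub_apply,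
    add_sub_cancel]
  simp [Matrix.one_apply]

/-- Measure the second factor with the test `P` and, depending on the outcome, apply one of two
channels to the first factor. -/
def measureThen {u v w : Type*} [Fintype u] [Fintype v] [DecidableEq v] [Fintype w]
    (P : Matrix v v ℂ) (N M : SuperOp u w) : SuperOp (u × v) w :=
  N ∘ₗ pairing u P + M ∘ₗ pairing u (1 - P)

theorem isChannel_measureThen {u v w : Type*} [Fintype u] [Fintype v] [DecidableEq v] [Fintype w]
    {P : Matrix v v ℂ} (hP : P.PosSemidef) (hP' : (1 - P).PosSemidef) {N M : SuperOp u w}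
    (hN : IsChannel N) (hM : IsChannel M) : IsChannel (measureThen P N M) where
  completelyPositive k X hX :=
    (hN.completelyPositive k _ (pairing_completelyPositive hP k X hX)).add
      (hM.completelyPositive k _ (pairing_completelyPositive hP' k X hX))
  tracePreserving X := by
    rw [← trace_pairing_add P X, measureThen, LinearMap.add_apply, trace_add,
      LinearMap.comp_apply, LinearMap.comp_apply, hN.tracePreserving, hM.tracePreserving]

/-- The superchannel that applies the given channel to a fixed state of the input system and an
ancilla, tests the output, and then applies one of two channels. -/
theorem exists_measure_prepare_superchannel {n m n' m' κ : Type*} [Fintype n] [Fintype m]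
    [DecidableEq m] [Fintype n'] [Fintype m'] [Fintype κ] [DecidableEq κ]
    {ω : Matrix (κ × n) (κ × n) ℂ} (hω : IsState ω) {P : Matrix (κ × m) (κ × m) ℂ}
    (hP : P.PosSemidef) (hP' : (1 - P).PosSemidef) {N M : SuperOp n' m'}
    (hN : IsChannel N) (hM : IsChannel M) :
    ∃ Θ : SuperOp n m → SuperOp n' m', IsSuperchannel Θ ∧ ∀ L,
      Θ L = (P * idTensor κ L ω).trace • N + ((1 - P) * idTensor κ L ω).trace • M := by
  -- The memory holds the untouched input `n'` together with the ancilla `κ` of the test state.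
  refine ⟨_, isSuperchannel_of_memory (κ := n' × κ)
    ((isChannel_relabel (Equiv.prodAssoc n' κ n).symm).comp (isChannel_append (u := n') hω))
    ((isChannel_measureThen hP hP' hN hM).comp (isChannel_relabel (Equiv.prodAssoc n' κ m))),
    fun L => ?_⟩
  have key : ∀ (Q : Matrix (κ × m) (κ × m) ℂ) (X : Matrix n' n' ℂ),
      pairing n' Q (relabel (Equiv.prodAssoc n' κ m) (idTensor (n' × κ) L
        (relabel (Equiv.prodAssoc n' κ n).symm (append n' ω X)))) =
      (Q * idTensor κ L ω).trace • X := by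
    intro Q X
    ext x y
    have h : ∀ p q : κ × m, (relabel (Equiv.prodAssoc n' κ m) (idTensor (n' × κ) L
        (relabel (Equiv.prodAssoc n' κ n).symm (append n' ω X)))) (x, p) (y, q) =
        X x y * idTensor κ L ω p q := by
      intro p q
      exact congrFun (congrFun (L.map_smul (X x y)
        (Matrix.of fun i j => ω (p.1, i) (q.1, j))) p.2) q.2
    simp only [pairing, LinearMap.coe_mk, AddHom.coe_mk, of_apply, h, Matrix.smul_apply,
      smul_eq_mul, trace, diag, Matrix.mul_apply]
    rw [Finset.sum_comm, Finset.sum_mul]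
    refine Finset.sum_congr rfl fun q _ => ?_
    rw [Finset.sum_mul]
    exact Finset.sum_congr rfl fun p _ => by ring
  ext1 X
  simp only [measureThen, LinearMap.comp_apply, LinearMap.add_apply, LinearMap.smul_apply, key,
    map_smul]

/-! ### Choi matrices and compactness -/

/-- The Choi matrix of a linear map. -/
def choi (n m : Type*) [Fintype n] [DecidableEq n] [Fintype m] :
    SuperOp n m →ₗ[ℝ] Matrix (n × m) (n × m) ℂ where
  toFun Φ := Matrix.of fun p q => Φ (single p.1 q.1 1) p.2 q.2
  map_add' _ _ := rfl
  map_smul' _ _ := rfl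

theorem choi_apply {n m : Type*} [Fintype n] [DecidableEq n] [Fintype m] (Φ : SuperOp n m)
    (p q : n × m) : choi n m Φ p q = Φ (single p.1 q.1 1) p.2 q.2 := rfl

theorem apply_eq_choi {n m : Type*} [Fintype n] [DecidableEq n] [Fintype m] (Φ : SuperOp n m)
    (X : Matrix n n ℂ) (a b : m) :
    Φ X a b = ∑ i, ∑ j, X i j * choi n m Φ (i, a) (j, b) := by
  nth_rw 1 [matrix_eq_sum_single X]
  simp only [map_sum, Matrix.sum_apply, choi_apply]
  refine Finset.sum_congr rfl fun i _ => Finset.sum_congr rfl fun j _ => ?_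
  have : single i j (X i j) = X i j • single i j (1 : ℂ) := by simp
  rw [this, map_smul, Matrix.smul_apply, smul_eq_mul]

/-- The linear map with a given Choi matrix. -/
def ofChoi {n m : Type*} [Fintype n] (J : Matrix (n × m) (n × m) ℂ) (X : Matrix n n ℂ) :
    Matrix m m ℂ :=
  Matrix.of fun a b => ∑ i, ∑ j, X i j * J (i, a) (j, b)

theorem ofChoi_choi {n m : Type*} [Fintype n] [DecidableEq n] [Fintype m] (Φ : SuperOp n m) :
    ofChoi (choi n m Φ) = fun X => Φ X := by
  ext X a b
  exact (apply_eq_choi Φ X a b).symm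

theorem ofChoi_single {n m : Type*} [Fintype n] [DecidableEq n] (J : Matrix (n × m) (n × m) ℂ)
    (p q : n × m) : ofChoi J (single p.1 q.1 1) p.2 q.2 = J p q := by
  simp [ofChoi, single_apply, ite_and]

theorem choi_injective {n m : Type*} [Fintype n] [DecidableEq n] [Fintype m] :
    Function.Injective (choi n m) := by
  intro Φ Ψ h
  ext1 X
  have := (ofChoi_choi Φ).symm.trans ((congrArg ofChoi h).trans (ofChoi_choi Ψ))
  exact congrFun this X

/-- A set of linear maps that is closed for pointwise convergence has a closed set of Choi
matrices. -/
theorem isClosed_choi_image {n m : Type*} [Fintype n] [DecidableEq n] [Fintype m]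
    {O : Set (SuperOp n m)}
    (hO : IsClosed ((fun (Φ : SuperOp n m) (X : Matrix n n ℂ) => Φ X) '' O)) :
    IsClosed (choi n m '' O) := by
  have hc : Continuous (ofChoi : Matrix (n × m) (n × m) ℂ → Matrix n n ℂ → Matrix m m ℂ) := by
    refine continuous_pi fun X => continuous_matrix fun a b => ?_
    exact continuous_finsetSum _ fun i _ => continuous_finsetSum _ fun j _ =>
      continuous_const.mul (continuous_id.matrix_elem _ _)
  convert hO.preimage hc using 1
  ext J
  constructor
  · rintro ⟨Φ, hΦ, rfl⟩
    exact ⟨Φ, hΦ, (ofChoi_choi Φ).symm⟩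
  · rintro ⟨Φ, hΦ, h⟩
    refine ⟨Φ, hΦ, ?_⟩
    ext p q
    rw [← ofChoi_single J p q, ← h, choi_apply]

/-- Every bipartite vector is `Ψ ⊗ 1` applied to the unnormalized maximally entangled vector, and
this factor commutes with `id ⊗ Φ`. -/
theorem idTensor_ketbra {n m : Type*} [Fintype n] [DecidableEq n] [Fintype m] [DecidableEq m]
    (Φ : SuperOp n m) (ψ : n × n → ℂ) :
    idTensor n Φ (ketbra ψ) = ((Matrix.of fun k i => ψ (k, i)) ⊗ₖ (1 : Matrix m m ℂ)) *
      choi n m Φ * ((Matrix.of fun k i => ψ (k, i)) ⊗ₖ (1 : Matrix m m ℂ))ᴴ := by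
  ext p q
  have h : idTensor n Φ (ketbra ψ) p q =
      Φ (Matrix.of fun i j => ketbra ψ (p.1, i) (q.1, j)) p.2 q.2 := rfl
  rw [h, apply_eq_choi]
  simp only [ketbra, vecMulVec_apply, of_apply, Matrix.mul_apply, Fintype.sum_prod_type,
    kroneckerMap_apply, conjTranspose_apply, Matrix.one_apply, mul_ite, mul_one, mul_zero,
    ite_mul, zero_mul, Finset.sum_ite_eq, Finset.mem_univ, if_true, Pi.star_apply,
    apply_ite star, star_zero, Finset.sum_mul]
  rw [Finset.sum_comm]
  exact Finset.sum_congr rfl fun j _ => Finset.sum_congr rfl fun i _ => by ring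

theorem choi_posSemidef {n m : Type*} [Fintype n] [DecidableEq n] [Fintype m]
    {Φ : SuperOp n m} (hΦ : IsChannel Φ) : (choi n m Φ).PosSemidef := by
  classical
  have h := hΦ.posSemidef_idTensor (k := n)
    (posSemidef_vecMulVec_self_star (fun p : n × n => if p.1 = p.2 then (1 : ℂ) else 0))
  have h1 : (Matrix.of fun k i : n => if k = i then (1 : ℂ) else 0) = 1 := by
    ext i j; simp [Matrix.one_apply]
  have h2 := idTensor_ketbra Φ (fun p : n × n => if p.1 = p.2 then (1 : ℂ) else 0)
  dsimp only at h2
  rw [h1, one_kronecker_one, Matrix.one_mul, conjTranspose_one, Matrix.mul_one] at h2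
  rw [← h2]
  exact h

/-- Trace preservation says that tracing out the output of the Choi matrix leaves the identity. -/
theorem trace_kronecker_one_mul_choi {n m : Type*} [Fintype n] [DecidableEq n] [Fintype m]
    [DecidableEq m] {Φ : SuperOp n m} (hΦ : IsChannel Φ) (s : Matrix n n ℂ) :
    ((s ⊗ₖ (1 : Matrix m m ℂ)) * choi n m Φ).trace = s.trace := by
  have h : ∀ i j : n, ∑ a, choi n m Φ (j, a) (i, a) = if j = i then 1 else 0 := by
    intro i j
    refine (hΦ.tracePreserving (single j i 1)).trans ?_
    by_cases hij : j = i
    · subst hij; simp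
    · simp [hij]
  simp only [trace, diag, Matrix.mul_apply, Fintype.sum_prod_type, kroneckerMap_apply,
    Matrix.one_apply, mul_ite, mul_one, mul_zero, ite_mul, zero_mul, Finset.sum_ite_eq,
    Finset.mem_univ, if_true]
  refine Finset.sum_congr rfl fun i _ => ?_
  rw [Finset.sum_comm]
  simp [← Finset.mul_sum, h]

theorem isClosed_posSemidef (a : Type*) [Fintype a] :
    IsClosed {A : Matrix a a ℂ | A.PosSemidef} := by
  have : {A : Matrix a a ℂ | A.PosSemidef} =
      {A | Aᴴ = A} ∩ ⋂ x : a → ℂ, {A | 0 ≤ star x ⬝ᵥ (A *ᵥ x)} := by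
    ext A
    simp [posSemidef_iff_dotProduct_mulVec, IsHermitian]
  rw [this]
  refine IsClosed.inter (isClosed_eq (by fun_prop) continuous_id) (isClosed_iInter fun x => ?_)
  exact isClosed_le continuous_const (by fun_prop)

theorem norm_apply_le_trace {a : Type*} [Fintype a] {A : Matrix a a ℂ}
    (hA : A.PosSemidef) (i j : a) : ‖A i j‖ ≤ A.trace.re := by
  classical
  have hSS := sqrt_mul_sqrt hA
  have hS := sqrt_conjTranspose A
  set S := CFC.sqrt A
  have h : ∀ p q, A p q = ∑ c, S p c * star (S q c) := fun p q => by
    rw [← hSS]; nth_rw 2 [← hS]; rfl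
  have hd : ∀ p, (A p p).re = ∑ c, ‖S p c‖ ^ 2 := fun p => by
    rw [h, Complex.re_sum]
    refine Finset.sum_congr rfl fun c _ => ?_
    rw [← Complex.normSq_eq_norm_sq, Complex.normSq_apply]; simp
  have hle : ∀ p, ∑ c, ‖S p c‖ ^ 2 ≤ A.trace.re := fun p => by
    rw [← hd, trace, Complex.re_sum]
    refine Finset.single_le_sum (f := fun p => (A p p).re) (fun q _ => ?_) (Finset.mem_univ p)
    rw [hd]; positivity
  calc ‖A i j‖ ≤ ∑ c, ‖S i c‖ * ‖S j c‖ := by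
        rw [h]
        refine (norm_sum_le _ _).trans (le_of_eq ?_)
        simp
    _ ≤ ∑ c, (‖S i c‖ ^ 2 + ‖S j c‖ ^ 2) / 2 :=
        Finset.sum_le_sum fun c _ => by nlinarith [sq_nonneg (‖S i c‖ - ‖S j c‖)]
    _ = ((∑ c, ‖S i c‖ ^ 2) + ∑ c, ‖S j c‖ ^ 2) / 2 := by
        rw [← Finset.sum_div, Finset.sum_add_distrib]
    _ ≤ A.trace.re := by linarith [hle i, hle j]

theorem isCompact_posSemidef_trace_le (a : Type*) [Fintype a] (c : ℝ) :
    IsCompact {A : Matrix a a ℂ | A.PosSemidef ∧ A.trace.re ≤ c} := by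
  have hbox : IsCompact (Set.univ.pi fun _ : a => Set.univ.pi fun _ : a =>
      Metric.closedBall (0 : ℂ) c) :=
    isCompact_univ_pi fun _ => isCompact_univ_pi fun _ => isCompact_closedBall _ _
  refine IsCompact.of_isClosed_subset hbox ?_ ?_
  · have h : IsClosed {A : Matrix a a ℂ | A.trace.re ≤ c} :=
      isClosed_le (Complex.continuous_re.comp continuous_id.matrix_trace) continuous_const
    exact (isClosed_posSemidef a).inter h
  · rintro A ⟨hA, hc⟩ i - j -
    rw [mem_closedBall_zero_iff]
    exact (norm_apply_le_trace hA i j).trans hc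

theorem isCompact_choi_image {n m : Type*} [Fintype n] [DecidableEq n] [Fintype m]
    {O : Set (SuperOp n m)} (hch : ∀ Φ ∈ O, IsChannel Φ)
    (hO : IsClosed ((fun (Φ : SuperOp n m) (X : Matrix n n ℂ) => Φ X) '' O)) :
    IsCompact (choi n m '' O) := by
  classical
  refine IsCompact.of_isClosed_subset
    (isCompact_posSemidef_trace_le (n × m) (Fintype.card n)) (isClosed_choi_image hO) ?_
  rintro _ ⟨Φ, hΦ, rfl⟩
  refine ⟨choi_posSemidef (hch Φ hΦ), le_of_eq ?_⟩
  have := trace_kronecker_one_mul_choi (hch Φ hΦ) (1 : Matrix n n ℂ)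
  rw [one_kronecker_one, Matrix.one_mul] at this
  rw [this]; simp

/-- The states whose fidelity with `σ` is bounded below form a closed set. -/
theorem isClosed_le_stateFidelity {a : Type*} [Fintype a] [DecidableEq a] {σ : Matrix a a ℂ}
    (hσ : IsState σ) (c : ℝ) :
    IsClosed {ρ : Matrix a a ℂ | IsState ρ ∧ c ≤ stateFidelity ρ σ} := by
  let b : Fin 2 → Fin 2 → Matrix (Fin 2 × a) (Fin 2 × a) ℂ → Matrix a a ℂ :=
    fun i j X => X.submatrix (fun x => (i, x)) (fun x => (j, x))
  have hb : ∀ i j, Continuous (b i j) := fun i j =>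
    continuous_matrix fun x y => continuous_id.matrix_elem _ _
  -- Fidelity as a semidefinite program: positive block matrices with diagonal blocks `ρ`, `σ` and
  -- off-diagonal trace at least `√c`. The desired set is the projection of this compact set; for
  -- negative `c`, `Real.sqrt c = 0` is harmless.
  let K : Set (Matrix (Fin 2 × a) (Fin 2 × a) ℂ) := {X | X.PosSemidef ∧ X.trace.re ≤ 2} ∩
    ({X | b 1 1 X = σ} ∩ ({X | (b 0 0 X).trace = 1} ∩
      {X | Real.sqrt c ≤ (b 0 1 X).trace.re}))
  have hK : IsCompact K := by
    refine (isCompact_posSemidef_trace_le _ 2).inter_right ?_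
    refine (isClosed_eq (hb 1 1) continuous_const).inter
      ((isClosed_eq (hb 0 0).matrix_trace continuous_const).inter
        (isClosed_le continuous_const (Complex.continuous_re.comp (hb 0 1).matrix_trace)))
  convert (hK.image (hb 0 0)).isClosed using 1
  ext ρ
  constructor
  · rintro ⟨hρ, hc⟩
    obtain ⟨A, hA, hA'⟩ := exists_purification hρ.1 σ
    let G : Matrix (Fin 2 × a) (a ⊕ a) ℂ := Matrix.of fun p c => ![A, purify σ] p.1 p.2 c
    have hG : ∀ i j, b i j (G * Gᴴ) = ![A, purify σ] i * (![A, purify σ] j)ᴴ := fun _ _ => rfl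
    have h00 : b 0 0 (G * Gᴴ) = ρ := (hG 0 0).trans hA
    have h11 : b 1 1 (G * Gᴴ) = σ := (hG 1 1).trans (purify_mul_conjTranspose hσ.1)
    have h01 : (b 0 1 (G * Gᴴ)).trace = (rootFidelity ρ σ : ℂ) := by rw [hG]; exact hA'
    refine ⟨G * Gᴴ, ⟨⟨posSemidef_self_mul_conjTranspose G, ?_⟩, h11, ?_, ?_⟩, h00⟩
    · have : (G * Gᴴ).trace = (b 0 0 (G * Gᴴ)).trace + (b 1 1 (G * Gᴴ)).trace := by
        simp only [trace, diag, Fintype.sum_prod_type, Fin.sum_univ_two]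
        rfl
      rw [this, h00, h11, hρ.2, hσ.2]
      norm_num
    · change (b 0 0 (G * Gᴴ)).trace = 1
      rw [h00, hρ.2]
    · change Real.sqrt c ≤ (b 0 1 (G * Gᴴ)).trace.re
      rw [h01, Complex.ofReal_re]
      exact Real.sqrt_le_iff.2 ⟨rootFidelity_nonneg _ _, hc⟩
  · rintro ⟨X, ⟨⟨hX, -⟩, h11, h00, h01⟩, rfl⟩
    refine ⟨⟨hX.submatrix _, h00⟩, ?_⟩
    have hSS := sqrt_mul_sqrt hX
    have hS := sqrt_conjTranspose X
    set S := CFC.sqrt X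
    have hblock : ∀ i j : Fin 2, S.submatrix (fun x => (i, x)) id *
        (S.submatrix (fun x => (j, x)) id)ᴴ = b i j X := by
      intro i j
      rw [← hSS]
      nth_rw 4 [← hS]
      ext x y
      simp [Matrix.mul_apply, b]
    have h := trace_re_le_rootFidelity (S.submatrix (fun x => ((0 : Fin 2), x)) id)
      (S.submatrix (fun x => ((1 : Fin 2), x)) id)
    rw [hblock, hblock, hblock, show b 1 1 X = σ from h11] at h
    exact (Real.sqrt_le_iff.1 (le_trans h01 h)).2

/-- The channels of a closed set whose worst-case fidelity with a given channel is bounded below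
have a closed set of Choi matrices. -/
theorem isClosed_choi_image_le_channelFidelity {n m : Type*} [Fintype n] [DecidableEq n]
    [Nonempty n] [Fintype m] [DecidableEq m] {O : Set (SuperOp n m)}
    (hch : ∀ Φ ∈ O, IsChannel Φ)
    (hO : IsClosed ((fun (Φ : SuperOp n m) (X : Matrix n n ℂ) => Φ X) '' O))
    {N : SuperOp n m} (hN : IsChannel N) (c : ℝ) :
    IsClosed (choi n m '' {Φ ∈ O | c ≤ channelFidelity Φ N}) := by
  let g : ∀ k : ℕ, Matrix (Fin k × n) (Fin k × n) ℂ → Matrix (n × m) (n × m) ℂ →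
      Matrix (Fin k × m) (Fin k × m) ℂ := fun k ρ J =>
    Matrix.of fun p q => ofChoi J (Matrix.of fun i j => ρ (p.1, i) (q.1, j)) p.2 q.2
  have hg : ∀ k ρ, Continuous (g k ρ) := fun k ρ => continuous_matrix fun p q =>
    continuous_finsetSum _ fun i _ => continuous_finsetSum _ fun j _ =>
      continuous_const.mul (continuous_id.matrix_elem _ _)
  have hgc : ∀ k ρ Φ, g k ρ (choi n m Φ) = idTensor (Fin k) Φ ρ := fun k ρ Φ => by
    ext p q
    simp only [g, ofChoi_choi]
    rfl
  have : choi n m '' {Φ ∈ O | c ≤ channelFidelity Φ N} = choi n m '' O ∩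
      ⋂ (k : ℕ) (ρ : Matrix (Fin k × n) (Fin k × n) ℂ) (_ : IsState ρ), g k ρ ⁻¹'
        {τ | IsState τ ∧ c ≤ stateFidelity τ (idTensor (Fin k) N ρ)} := by
    ext J
    constructor
    · rintro ⟨Φ, ⟨hΦ, hc⟩, rfl⟩
      refine ⟨⟨Φ, hΦ, rfl⟩, ?_⟩
      simp only [Set.mem_iInter, Set.mem_preimage, hgc]
      exact fun k ρ hρ => ⟨((hch Φ hΦ).idTensor _).isState hρ, le_channelFidelity_iff.1 hc k ρ hρ⟩
    · rintro ⟨⟨Φ, hΦ, rfl⟩, h⟩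
      simp only [Set.mem_iInter, Set.mem_preimage, hgc] at h
      exact ⟨Φ, ⟨hΦ, le_channelFidelity_iff.2 fun k ρ hρ => (h k ρ hρ).2⟩, rfl⟩
  rw [this]
  exact (isClosed_choi_image hO).inter (isClosed_iInter fun k => isClosed_iInter fun ρ =>
    isClosed_iInter fun hρ =>
      (isClosed_le_stateFidelity ((hN.idTensor _).isState hρ) c).preimage (hg k ρ))

/-! ### Testers -/

/-- Testers: operators on the Choi space that describe a test of the output of a channel which
is applied to part of a state. -/
def testers (n m : Type*) [Fintype n] [Fintype m] [DecidableEq m] :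
    Set (Matrix (n × m) (n × m) ℂ) :=
  {Q | Q.PosSemidef ∧ ∃ s : Matrix n n ℂ, IsState s ∧ (s ⊗ₖ (1 : Matrix m m ℂ) - Q).PosSemidef}

theorem convex_setOf_isState (n : Type*) [Fintype n] : Convex ℝ {s : Matrix n n ℂ | IsState s} := by
  rintro s ⟨hs, hs'⟩ t ⟨ht, ht'⟩ a b ha hb hab
  refine ⟨(hs.smul ha).add (ht.smul hb), ?_⟩
  rw [trace_add, trace_smul, trace_smul, hs', ht', ← add_smul, hab, one_smul]

theorem convex_testers (n m : Type*) [Fintype n] [Fintype m] [DecidableEq m] :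
    Convex ℝ (testers n m) := by
  rintro Q ⟨hQ, s, hs, hQs⟩ R ⟨hR, t, ht, hRt⟩ a b ha hb hab
  refine ⟨(hQ.smul ha).add (hR.smul hb), a • s + b • t,
    convex_setOf_isState n hs ht ha hb hab, ?_⟩
  have : (a • s + b • t) ⊗ₖ (1 : Matrix m m ℂ) - (a • Q + b • R) =
      a • (s ⊗ₖ (1 : Matrix m m ℂ) - Q) + b • (t ⊗ₖ (1 : Matrix m m ℂ) - R) := by
    rw [add_kronecker, smul_kronecker, smul_kronecker, smul_sub, smul_sub]
    abel
  rw [this]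
  exact (hQs.smul ha).add (hRt.smul hb)

/-- The witness `s` ranges over a compact set too, so the testers are a projection of a compact set
of pairs. -/
theorem isCompact_testers (n m : Type*) [Fintype n] [Fintype m] [DecidableEq m] :
    IsCompact (testers n m) := by
  have hk : Continuous fun s : Matrix n n ℂ => s ⊗ₖ (1 : Matrix m m ℂ) :=
    continuous_matrix fun p q => (continuous_id.matrix_elem _ _).mul continuous_const
  have hK : IsCompact (({s : Matrix n n ℂ | s.PosSemidef ∧ s.trace.re ≤ 1} ×ˢ
      {Q : Matrix (n × m) (n × m) ℂ | Q.PosSemidef ∧ Q.trace.re ≤ Fintype.card m}) ∩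
      ({x | x.1.trace = 1} ∩
        (fun x => x.1 ⊗ₖ (1 : Matrix m m ℂ) - x.2) ⁻¹' {A | A.PosSemidef})) := by
    refine ((isCompact_posSemidef_trace_le n 1).prod
      (isCompact_posSemidef_trace_le (n × m) _)).inter_right (IsClosed.inter ?_ ?_)
    · exact isClosed_eq continuous_fst.matrix_trace continuous_const
    · exact (isClosed_posSemidef _).preimage ((hk.comp continuous_fst).sub continuous_snd)
  convert hK.image continuous_snd using 1
  ext Q
  constructor
  · rintro ⟨hQ, s, hs, hQs⟩
    refine ⟨(s, Q), ⟨⟨⟨hs.1, ?_⟩, hQ, ?_⟩, hs.2, hQs⟩, rfl⟩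
    · rw [hs.2]; exact le_rfl
    · have h := (Complex.le_def.1 hQs.trace_nonneg).1
      rw [trace_sub, trace_kronecker, hs.2, one_mul, trace_one] at h
      simpa using h
  · rintro ⟨⟨s, Q'⟩, ⟨⟨⟨hs, -⟩, hQ, -⟩, hs1, hQs⟩, rfl⟩
    exact ⟨hQ, s, ⟨hs, hs1⟩, hQs⟩

/-- A test of the output of a channel applied to a pure state is described by a tester. -/
theorem exists_tester_of_test {n m : Type*} [Fintype n] [DecidableEq n] [Fintype m]
    [DecidableEq m] {ψ : n × n → ℂ} (hψ : star ψ ⬝ᵥ ψ = 1) {P : Matrix (n × m) (n × m) ℂ}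
    (hP : P.PosSemidef) (hP' : (1 - P).PosSemidef) :
    ∃ Q ∈ testers n m, ∀ Φ : SuperOp n m,
      (P * idTensor n Φ (ketbra ψ)).trace = (Q * choi n m Φ).trace := by
  let Ψ : Matrix n n ℂ := Matrix.of fun k i => ψ (k, i)
  let V := Ψ ⊗ₖ (1 : Matrix m m ℂ)
  refine ⟨Vᴴ * P * V, ⟨hP.conjTranspose_mul_mul_same V, Ψᴴ * Ψ,
    ⟨posSemidef_conjTranspose_mul_self Ψ, ?_⟩, ?_⟩, fun Φ => ?_⟩
  · rw [← hψ, trace, dotProduct, Fintype.sum_prod_type, Finset.sum_comm]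
    rfl
  · have : (Ψᴴ * Ψ) ⊗ₖ (1 : Matrix m m ℂ) - Vᴴ * P * V = Vᴴ * (1 - P) * V := by
      rw [Matrix.mul_sub, Matrix.sub_mul, Matrix.mul_one, conjTranspose_kronecker,
        ← mul_kronecker_mul, conjTranspose_one, Matrix.one_mul]
    rw [this]
    exact hP'.conjTranspose_mul_mul_same V
  · rw [idTensor_ketbra, ← Matrix.mul_assoc, trace_mul_comm]
    simp only [Matrix.mul_assoc, V, Ψ]

/-- Every tester is realized by a test of the output of a channel applied to a pure state. -/
theorem exists_test_of_tester {n m : Type*} [Fintype n] [DecidableEq n] [Fintype m]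
    [DecidableEq m] {Q : Matrix (n × m) (n × m) ℂ} (hQ : Q ∈ testers n m) :
    ∃ (ψ : n × n → ℂ) (P : Matrix (n × m) (n × m) ℂ), star ψ ⬝ᵥ ψ = 1 ∧ P.PosSemidef ∧
      (1 - P).PosSemidef ∧ ∀ Φ : SuperOp n m,
        (P * idTensor n Φ (ketbra ψ)).trace = (Q * choi n m Φ).trace := by
  obtain ⟨hQ, s, hs, hQs⟩ := hQ
  have hr := sqrt_conjTranspose s
  have hrr := sqrt_mul_sqrt hs.1
  have hrp := sqrt_posSemidef s
  set r := CFC.sqrt s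
  have hG : fromCols (CFC.sqrt Q) (CFC.sqrt (s ⊗ₖ (1 : Matrix m m ℂ) - Q)) *
      (fromCols (CFC.sqrt Q) (CFC.sqrt (s ⊗ₖ (1 : Matrix m m ℂ) - Q)))ᴴ =
        s ⊗ₖ (1 : Matrix m m ℂ) := by
    rw [conjTranspose_fromCols_eq_fromRows_conjTranspose, fromCols_mul_fromRows,
      sqrt_conjTranspose, sqrt_conjTranspose, sqrt_mul_sqrt hQ, sqrt_mul_sqrt hQs,
      add_sub_cancel]
  -- The first block `U₁` satisfies `(√s ⊗ 1) U₁ = √Q`, so `P = U₁ U₁ᴴ` plays the role of `(s ⊗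
  -- 1)^(-1/2) Q (s ⊗ 1)^(-1/2)` even when `s` is singular.
  obtain ⟨U, hU, hU1, -⟩ := exists_polar
    (fromCols (CFC.sqrt Q) (CFC.sqrt (s ⊗ₖ (1 : Matrix m m ℂ) - Q)))
  have hsq : CFC.sqrt (s ⊗ₖ (1 : Matrix m m ℂ)) = r ⊗ₖ (1 : Matrix m m ℂ) := by
    refine CFC.sqrt_unique ?_ (hrp.kronecker PosSemidef.one).nonneg
    rw [← mul_kronecker_mul, hrr, Matrix.one_mul]
  rw [hG, hsq] at hU
  have hU' : U = fromCols U.toCols₁ U.toCols₂ := (fromCols_toCols U).symm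
  have hUU : U * Uᴴ = U.toCols₁ * U.toCols₁ᴴ + U.toCols₂ * U.toCols₂ᴴ := by
    conv_lhs => rw [hU', conjTranspose_fromCols_eq_fromRows_conjTranspose, fromCols_mul_fromRows]
  have hVU : (r ⊗ₖ (1 : Matrix m m ℂ)) * U.toCols₁ = CFC.sqrt Q := by
    rw [hU', mul_fromCols] at hU
    exact (fromCols_inj hU).1
  refine ⟨fun p => r p.1 p.2, U.toCols₁ * U.toCols₁ᴴ, ?_, posSemidef_self_mul_conjTranspose _,
    ?_, fun Φ => ?_⟩
  · have : (rᴴ * r).trace = 1 := by rw [hr, hrr, hs.2]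
    rw [← this, trace, dotProduct, Fintype.sum_prod_type, Finset.sum_comm]
    rfl
  · have : 1 - U.toCols₁ * U.toCols₁ᴴ = (1 - U * Uᴴ) + U.toCols₂ * U.toCols₂ᴴ := by
      rw [hUU]; abel
    rw [this]
    exact hU1.add (posSemidef_self_mul_conjTranspose _)
  · rw [idTensor_ketbra]
    have hof : (Matrix.of fun k i => r k i) = r := rfl
    dsimp only
    rw [hof, ← Matrix.mul_assoc, trace_mul_comm]
    congr 1
    rw [← Matrix.mul_assoc, ← Matrix.mul_assoc]
    congr 1
    rw [← sqrt_mul_sqrt hQ]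
    nth_rw 2 [← sqrt_conjTranspose Q]
    rw [← hVU, conjTranspose_mul, conjTranspose_kronecker, hr, conjTranspose_one]
    simp only [Matrix.mul_assoc]

/-- The probability with which a tester accepts a channel. -/
def accept {n m : Type*} [Fintype n] [DecidableEq n] [Fintype m]
    (Q : Matrix (n × m) (n × m) ℂ) : SuperOp n m →ₗ[ℝ] ℝ where
  toFun Φ := (Q * choi n m Φ).trace.re
  map_add' Φ Ψ := by simp [Matrix.mul_add]
  map_smul' c Φ := by simp

theorem accept_apply {n m : Type*} [Fintype n] [DecidableEq n] [Fintype m]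
    (Q : Matrix (n × m) (n × m) ℂ) (Φ : SuperOp n m) :
    accept Q Φ = (Q * choi n m Φ).trace.re := rfl

theorem accept_nonneg {n m : Type*} [Fintype n] [DecidableEq n] [Fintype m] [DecidableEq m]
    {Q : Matrix (n × m) (n × m) ℂ} (hQ : Q ∈ testers n m) {Φ : SuperOp n m} (hΦ : IsChannel Φ) :
    0 ≤ accept Q Φ :=
  trace_mul_re_nonneg hQ.1 (choi_posSemidef hΦ)

theorem accept_le_one {n m : Type*} [Fintype n] [DecidableEq n] [Fintype m] [DecidableEq m]
    {Q : Matrix (n × m) (n × m) ℂ} (hQ : Q ∈ testers n m) {Φ : SuperOp n m} (hΦ : IsChannel Φ) :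
    accept Q Φ ≤ 1 := by
  obtain ⟨-, s, hs, hQs⟩ := hQ
  have h := trace_mul_re_nonneg hQs (choi_posSemidef hΦ)
  rw [Matrix.sub_mul, trace_sub, trace_kronecker_one_mul_choi hΦ, hs.2] at h
  rw [accept_apply]
  simpa using h

/-- The superchannel that uses a tester and then prepares one of two channels. -/
theorem exists_superchannel_of_tester {n m n' m' : Type*} [Fintype n] [DecidableEq n] [Fintype m]
    [DecidableEq m] [Fintype n'] [Fintype m'] {Q : Matrix (n × m) (n × m) ℂ}
    (hQ : Q ∈ testers n m) {N M : SuperOp n' m'} (hN : IsChannel N) (hM : IsChannel M) :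
    ∃ Θ : SuperOp n m → SuperOp n' m', IsSuperchannel Θ ∧ ∀ L, IsChannel L →
      Θ L = accept Q L • N + (1 - accept Q L) • M := by
  obtain ⟨ψ, P, hψ, hP, hP', hPQ⟩ := exists_test_of_tester hQ
  have hω : IsState (ketbra ψ) := by
    refine ⟨posSemidef_vecMulVec_self_star ψ, ?_⟩
    rw [ketbra, trace_vecMulVec, dotProduct_comm, hψ]
  obtain ⟨Θ, hΘ, hΘL⟩ := exists_measure_prepare_superchannel hω hP hP' hN hM
  refine ⟨Θ, hΘ, fun L hL => ?_⟩
  have htr : (idTensor n L (ketbra ψ)).trace = 1 := (trace_idTensor hL _).trans hω.2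
  -- The trace of a product of two Hermitian matrices is real, so `accept` loses nothing by taking
  -- real parts.
  have hacc : (Q * choi n m L).trace = ((accept Q L : ℝ) : ℂ) := by
    have h : (Q * choi n m L).trace = star (Q * choi n m L).trace := by
      rw [← trace_conjTranspose, conjTranspose_mul, hQ.1.isHermitian.eq,
        (choi_posSemidef hL).isHermitian.eq, trace_mul_comm]
    exact (Complex.conj_eq_iff_re.1 h.symm).symm
  rw [hΘL, Matrix.sub_mul, Matrix.one_mul, trace_sub, htr, hPQ, hacc]
  ext X a b
  simp

/-! ### Minimax: one tester for all free maps -/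

/-- A minimax statement: if every point of a convex set has a point of the compact convex set `K`
at which the bilinear pairing is arbitrarily close to being at most `q`, then some point of `K`
works for all of them. -/
theorem exists_forall_le_of_forall_exists_le {V W : Type*} [AddCommGroup V] [Module ℝ V]
    [TopologicalSpace V] [IsTopologicalAddGroup V] [ContinuousSMul ℝ V]
    [AddCommGroup W] [Module ℝ W] [TopologicalSpace W] [IsTopologicalAddGroup W]
    [ContinuousSMul ℝ W] {K : Set V} (hK : IsCompact K) (hKc : Convex ℝ K) (hKn : K.Nonempty)
    {S : Set W} (hS : Convex ℝ S) (f : V →ₗ[ℝ] W →ₗ[ℝ] ℝ)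
    (hf₁ : ∀ y, Continuous fun x => f x y) (hf₂ : ∀ x, Continuous fun y => f x y) {q : ℝ}
    (h : ∀ y ∈ S, ∀ η > 0, ∃ x ∈ K, f x y ≤ q + η) :
    ∃ x ∈ K, ∀ y ∈ S, f x y ≤ q := by
  by_contra! hcon
  -- Finitely many `y` defeat all of `K`; Sion's lemma merges them into a single `y`. On compact `K`
  -- its gap above `q` is uniform, and half of that gap is used as `η`.
  obtain ⟨s, hsS, hs, hcov⟩ := hK.elim_finite_subcover_image (b := S)
    (c := fun y => {x | q < f x y}) (fun y _ => isOpen_lt continuous_const (hf₁ y))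
    (fun x hx => by
      obtain ⟨y, hy, hxy⟩ := hcon x hx
      exact Set.mem_biUnion hy hxy)
  obtain ⟨y, hy, hlt⟩ := Sion.exists_lt_iInf_of_lt_iInf_of_finite (X := K) (Y := S)
    (f := fun x y => f x y) hKn hK
    (fun y _ => (hf₁ y).lowerSemicontinuous.lowerSemicontinuousOn K)
    (fun y _ => ((f.flip y).convexOn hKc).quasiconvexOn) hS
    (fun x _ => (hf₂ x).upperSemicontinuous.upperSemicontinuousOn S)
    (fun x _ => ((f x).concaveOn hS).quasiconcaveOn) hKc hs hsS (t := q)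
    (fun x hx => by simpa using hcov hx)
  obtain ⟨x, hx, hmin⟩ := hK.exists_isMinOn hKn (hf₁ y).continuousOn
  obtain ⟨x', hx', hle⟩ := h y hy ((f x y - q) / 2) (by linarith [hlt x hx])
  have h1 : f x y ≤ f x' y := hmin hx'
  linarith [hlt x hx]

/-- The pairing of operators. -/
def tracePairing (a : Type*) [Fintype a] : Matrix a a ℂ →ₗ[ℝ] Matrix a a ℂ →ₗ[ℝ] ℝ :=
  LinearMap.mk₂ ℝ (fun A B => (A * B).trace.re) (by simp [Matrix.add_mul]) (by simp)
    (by simp [Matrix.mul_add]) (by simp)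

/-- The slack `η` is needed because the supremum over tests is not assumed attained. It also covers
`q = 0`, where the reciprocal is `∞`. -/
theorem exists_tester_of_le_hypTestMeasure {n m : Type*} [Fintype n] [DecidableEq n]
    [Fintype m] [DecidableEq m] {S : Set (SuperOp n m)} {δ : ℝ} {E : SuperOp n m} {q : ℝ}
    (hq : 0 ≤ q) (h : (ENNReal.ofReal q)⁻¹ ≤ hypTestMeasure S δ E) {M : SuperOp n m}
    (hM : M ∈ S) {η : ℝ} (hη : 0 < η) :
    ∃ Q ∈ testers n m, 1 - δ ≤ accept Q E ∧ accept Q M ≤ q + η := by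
  by_contra! hcon
  have h1 : hypTestMeasure S δ E ≤ (ENNReal.ofReal (q + η))⁻¹ := by
    refine (iInf₂_le M hM).trans (iSup₂_le fun ψ hψ => iSup₂_le fun P hP => ?_)
    obtain ⟨Q, hQ, hPQ⟩ := exists_tester_of_test hψ hP.1 hP.2.1
    have h2 := hcon Q hQ (by rw [accept_apply, ← hPQ]; exact hP.2.2)
    rw [accept_apply, ← hPQ] at h2
    exact ENNReal.inv_le_inv.2 (ENNReal.ofReal_le_ofReal h2.le)
  have h3 := ENNReal.inv_le_inv.1 (h.trans h1)
  rw [ENNReal.ofReal_le_ofReal_iff hq] at h3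
  linarith

/-- If the hypothesis testing measure is at least `1 / q`, then a single tester certifies this for
all elements of a convex set. -/
theorem exists_tester_forall_accept_le {n m : Type*} [Fintype n] [DecidableEq n]
    [Fintype m] [DecidableEq m] {S : Set (SuperOp n m)} (hS : Convex ℝ S) (hSn : S.Nonempty)
    {δ : ℝ} {E : SuperOp n m} {q : ℝ}
    (hq : 0 ≤ q) (h : (ENNReal.ofReal q)⁻¹ ≤ hypTestMeasure S δ E) :
    ∃ Q ∈ testers n m, 1 - δ ≤ accept Q E ∧ ∀ M ∈ S, accept Q M ≤ q := by
  have hc₁ : ∀ B : Matrix (n × m) (n × m) ℂ,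
      Continuous fun A => tracePairing (n × m) A B := fun B =>
    Complex.continuous_re.comp (continuous_id.matrix_mul continuous_const).matrix_trace
  have hc₂ : ∀ A : Matrix (n × m) (n × m) ℂ,
      Continuous fun B => tracePairing (n × m) A B := fun A =>
    Complex.continuous_re.comp (continuous_const.matrix_mul continuous_id).matrix_trace
  obtain ⟨M₀, hM₀⟩ := hSn
  obtain ⟨Q₀, hQ₀, hQ₀E, -⟩ := exists_tester_of_le_hypTestMeasure hq h hM₀ one_pos
  have hcl : IsClosed {Q | 1 - δ ≤ tracePairing (n × m) Q (choi n m E)} :=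
    isClosed_le continuous_const (hc₁ _)
  have hcv : Convex ℝ {Q | 1 - δ ≤ tracePairing (n × m) Q (choi n m E)} :=
    convex_halfSpace_ge ((tracePairing (n × m)).flip (choi n m E)).isLinear _
  obtain ⟨Q, ⟨hQ, hQE⟩, hQS⟩ := exists_forall_le_of_forall_exists_le
    ((isCompact_testers n m).inter_right hcl) ((convex_testers n m).inter hcv) ⟨Q₀, hQ₀, hQ₀E⟩
    (hS.linear_image (choi n m)) (tracePairing (n × m)) hc₁ hc₂ (q := q) (by
      rintro _ ⟨M, hM, rfl⟩ η hη
      obtain ⟨Q, hQ, hQE, hQM⟩ := exists_tester_of_le_hypTestMeasure hq h hM hη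
      exact ⟨Q, ⟨hQ, hQE⟩, hQM⟩)
  exact ⟨Q, hQ, hQE, fun M hM => hQS _ ⟨M, hM, rfl⟩⟩

/-! ### Sufficient conditions for a conversion -/

theorem one_le_channelFidelity_self {n m : Type*} [Fintype n] [Nonempty n] [Fintype m]
    [DecidableEq m] {Φ : SuperOp n m} (hΦ : IsChannel Φ) : 1 ≤ channelFidelity Φ Φ := by
  rw [le_channelFidelity_iff]
  intro k ρ hρ
  have hτ := (hΦ.idTensor (Fin k)).isState hρ
  set τ := idTensor (Fin k) Φ ρ
  have h := trace_re_le_rootFidelity (CFC.sqrt τ) (CFC.sqrt τ)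
  rw [sqrt_conjTranspose, sqrt_mul_sqrt hτ.1, hτ.2, Complex.one_re] at h
  exact one_le_pow₀ h

theorem mul_le_channelFidelity_mixture {n m : Type*} [Fintype n] [Nonempty n] [Fintype m]
    [DecidableEq m] {Φ Ψ N : SuperOp n m} (hΦ : IsChannel Φ) (hΨ : IsChannel Ψ)
    (hN : IsChannel N) {t c : ℝ} (ht : 0 ≤ t) (ht' : t ≤ 1) (h : c ≤ channelFidelity Φ N) :
    t * c ≤ channelFidelity (t • Φ + (1 - t) • Ψ) N := by
  rw [le_channelFidelity_iff] at h ⊢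
  intro k ρ hρ
  have h1 := mul_stateFidelity_le_add ((hΦ.idTensor (Fin k)).isState hρ).1
    ((hN.idTensor (Fin k)).isState hρ).1
    (((hΨ.idTensor (Fin k)).isState hρ).1.smul (sub_nonneg.2 ht')) ht
  have h2 : idTensor (Fin k) (t • Φ + (1 - t) • Ψ) ρ =
      (t : ℂ) • idTensor (Fin k) Φ ρ + (1 - t) • idTensor (Fin k) Ψ ρ := by
    ext p q
    simp [idTensor]
  rw [h2]
  exact (mul_le_mul_of_nonneg_left (h k ρ hρ) ht).trans h1

theorem exists_conversion_of_tester {n m n' m' : Type*} [Fintype n] [DecidableEq n] [Fintype m]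
    [DecidableEq m] [Fintype n'] [Nonempty n'] [Fintype m'] [DecidableEq m']
    {T : ResourceTheory n m} {T' : ResourceTheory n' m'} {E : SuperOp n m} (hE : E ∈ T.allowed)
    {N : SuperOp n' m'} (hN : N ∈ T'.allowed) (hconv : Convex ℝ T'.allowed) {ε δ : ℝ}
    (hε : 0 ≤ ε) (hε' : ε ≤ 1) (hδ : 0 ≤ δ) {Q : Matrix (n × m) (n × m) ℂ}
    (hQ : Q ∈ testers n m) (hQE : 1 - δ ≤ accept Q E) {N' M' : SuperOp n' m'}
    (hN' : N' ∈ T'.allowed) (hM' : M' ∈ T'.allowed) (hF : 1 - ε ≤ channelFidelity N' N)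
    (hfree : ∀ M ∈ T.free, accept Q M • N' + (1 - accept Q M) • M' ∈ T'.free) :
    ∃ Θ ∈ freeSuperchannels T T', 1 - ε - 2 * δ ≤ channelFidelity (Θ E) N := by
  have hch := T.allowed_isChannel
  have hch' := T'.allowed_isChannel
  obtain ⟨Θ, hΘ, hΘL⟩ := exists_superchannel_of_tester hQ (hch' N' hN') (hch' M' hM')
  refine ⟨Θ, ⟨hΘ, fun L hL => ?_, fun M hM => ?_⟩, ?_⟩
  · rw [hΘL L (hch L hL)]
    exact hconv hN' hM' (accept_nonneg hQ (hch L hL))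
      (sub_nonneg.2 (accept_le_one hQ (hch L hL))) (add_sub_cancel _ _)
  · rw [hΘL M (hch M (T.free_subset hM))]
    exact hfree M hM
  · rw [hΘL E (hch E hE)]
    refine le_trans ?_ (mul_le_channelFidelity_mixture (hch' N' hN') (hch' M' hM') (hch' N hN)
      (accept_nonneg hQ (hch E hE)) (accept_le_one hQ (hch E hE)) hF)
    -- The mixture has fidelity at least `(1 - δ) * (1 - ε)`, which exceeds the claimed bound by `δ
    -- + ε * δ`.
    have := mul_le_mul_of_nonneg_right hQE (sub_nonneg.2 hε')
    nlinarith [mul_nonneg hδ hε]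

/-- The smoothed robustness is attained: there is an optimal mixture that is free. The value `p` is
the reciprocal of the robustness, and `p = 0` if the latter is infinite. -/
theorem exists_optimal_mixture {n m : Type*} [Fintype n] [DecidableEq n] [Nonempty n] [Fintype m]
    [DecidableEq m] {T : ResourceTheory n m} {N : SuperOp n m} (hN : N ∈ T.allowed)
    (hcl : IsClosed ((fun (Φ : SuperOp n m) (X : Matrix n n ℂ) => Φ X) '' T.allowed))
    {O : Set (SuperOp n m)} (hfree : T.free ⊆ O) (hO : O ⊆ T.allowed)
    (hOcl : IsClosed ((fun (Φ : SuperOp n m) (X : Matrix n n ℂ) => Φ X) '' O))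
    {ε : ℝ} (hε : 0 ≤ ε) :
    ∃ p : ℝ, 0 ≤ p ∧ p ≤ 1 ∧ ∃ N' ∈ T.allowed, 1 - ε ≤ channelFidelity N' N ∧
      (∃ M' ∈ O, p • N' + (1 - p) • M' ∈ T.free) ∧
      (ENNReal.ofReal p)⁻¹ ≤ smooth T (robustness T.free O) ε N := by
  have hch := T.allowed_isChannel
  have hC₁ : IsCompact (choi n m '' {Φ ∈ T.allowed | 1 - ε ≤ channelFidelity Φ N}) :=
    (isCompact_choi_image hch hcl).of_isClosed_subset
      (isClosed_choi_image_le_channelFidelity hch hcl (hch N hN) _)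
      (Set.image_mono fun _ h => h.1)
  have hC₂ := isCompact_choi_image (fun Φ hΦ => hch Φ (hO hΦ)) hOcl
  have hg : Continuous fun x : ℝ × Matrix (n × m) (n × m) ℂ × Matrix (n × m) (n × m) ℂ =>
      x.1 • x.2.1 + (1 - x.1) • x.2.2 := by fun_prop
  -- Maximizing `p` over compact triples (weight, channel near `N`, noise) handles the smoothing and
  -- the robustness infimum together. Weight `0` is always feasible, and a robustness decomposition
  -- with parameter `r` has weight `(1 + r)⁻¹`.
  have hK := ((isCompact_Icc (a := (0 : ℝ)) (b := 1)).prod (hC₁.prod hC₂)).inter_right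
    ((isClosed_choi_image T.free_closed).preimage hg)
  have hmem : ∀ {p : ℝ} {N' M' : SuperOp n m}, 0 ≤ p → p ≤ 1 → N' ∈ T.allowed →
      1 - ε ≤ channelFidelity N' N → M' ∈ O → p • N' + (1 - p) • M' ∈ T.free →
      (p, choi n m N', choi n m M') ∈ ((Set.Icc (0 : ℝ) 1) ×ˢ
        ((choi n m '' {Φ ∈ T.allowed | 1 - ε ≤ channelFidelity Φ N}) ×ˢ (choi n m '' O))) ∩
        (fun x => x.1 • x.2.1 + (1 - x.1) • x.2.2) ⁻¹' (choi n m '' T.free) := by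
    intro p N' M' hp hp' hN' hF hM' hmix
    refine ⟨⟨⟨hp, hp'⟩, ⟨N', ⟨hN', hF⟩, rfl⟩, ⟨M', hM', rfl⟩⟩, ⟨_, hmix, ?_⟩⟩
    simp only [map_add, map_smul]
  obtain ⟨M₀, hM₀⟩ := T.free_nonempty
  have hNN : 1 - ε ≤ channelFidelity N N := by linarith [one_le_channelFidelity_self (hch N hN)]
  obtain ⟨⟨p, J₁, J₂⟩, ⟨⟨hp, ⟨N', ⟨hN', hF⟩, hJ₁⟩, ⟨M', hM', hJ₂⟩⟩, ⟨X, hX, hXJ⟩⟩, hmax⟩ :=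
    hK.exists_isMaxOn ⟨_, hmem le_rfl zero_le_one hN hNN (hfree hM₀) (by simpa using hM₀)⟩
      continuous_fst.continuousOn
  dsimp only at hp hJ₁ hJ₂ hXJ
  subst hJ₁ hJ₂
  refine ⟨p, hp.1, hp.2, N', hN', hF, ⟨M', hM', ?_⟩, ?_⟩
  · have : X = p • N' + (1 - p) • M' := choi_injective (by simpa using hXJ)
    rwa [← this]
  · refine le_sInf ?_
    rintro v ⟨L, hL, hLF, rfl⟩
    refine le_sInf ?_
    rintro v ⟨r, hr, ⟨M, hM, hmix⟩, rfl⟩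
    have hr1 : 0 < 1 + r := by linarith
    have hle : (1 + r)⁻¹ ≤ p := hmax (hmem (inv_nonneg.2 hr1.le)
      (inv_le_one_of_one_le₀ (by linarith)) hL hLF hM (by
        convert hmix using 1
        rw [smul_add, smul_smul]
        congr 2
        field_simp
        ring))
    rw [← inv_inv (ENNReal.ofReal (1 + r)), ← ENNReal.ofReal_inv_of_pos hr1]
    exact ENNReal.inv_le_inv.2 (ENNReal.ofReal_le_ofReal hle)

theorem exists_conversion_of_standardRobustness_le {n m n' m' : Type*} [Fintype n] [DecidableEq n]
    [Fintype m] [DecidableEq m] [Fintype n'] [DecidableEq n'] [Nonempty n'] [Fintype m']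
    [DecidableEq m'] {T : ResourceTheory n m} {T' : ResourceTheory n' m'} {E : SuperOp n m}
    (hE : E ∈ T.allowed) {N : SuperOp n' m'} (hN : N ∈ T'.allowed) (hconv : Convex ℝ T'.allowed)
    (hcl : IsClosed ((fun (Φ : SuperOp n' m') (X : Matrix n' n' ℂ) => Φ X) '' T'.allowed))
    {ε δ : ℝ} (hε : 0 ≤ ε) (hε' : ε ≤ 1) (hδ : 0 ≤ δ)
    (h : smooth T' (standardRobustness T') ε N ≤ hypTestMeasure T.free δ E) :
    ∃ Θ ∈ freeSuperchannels T T', 1 - ε - 2 * δ ≤ channelFidelity (Θ E) N := by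
  obtain ⟨p, hp, -, N', hN', hF, ⟨M', hM', hmix⟩, hpR⟩ := exists_optimal_mixture hN hcl
    subset_rfl T'.free_subset T'.free_closed hε
  obtain ⟨Q, hQ, hQE, hQM⟩ := exists_tester_forall_accept_le T.free_convex T.free_nonempty hp
    (hpR.trans h)
  refine exists_conversion_of_tester hE hN hconv hε hε' hδ hQ hQE hN' (T'.free_subset hM') hF
    fun M hM => ?_
  have ha := accept_nonneg hQ (T.allowed_isChannel M (T.free_subset hM))
  have hap := hQM M hM
  set a := accept Q M
  -- For `p = 0` no free channel is ever accepted. Otherwise the output is the convex combination of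
  -- the free mixture and `M'` with weight `a / p` on the mixture.
  rcases hp.eq_or_lt with rfl | hp0
  · rwa [le_antisymm hap ha]
  · have hc := T'.free_convex hmix hM' (div_nonneg ha hp) (sub_nonneg.2 (div_le_one_of_le₀ hap hp))
      (add_sub_cancel _ _)
    convert hc using 1
    rw [smul_add, smul_smul, smul_smul, add_assoc, ← add_smul]
    congr 2
    · field_simp
    · field_simp
      ring

/-- The tester `s ⊗ 1` accepts every channel with certainty; mixing it in with weight `c` sends each
acceptance probability `x` to `(1 - c) * x + c`. -/
theorem exists_tester_accept_eq {n m : Type*} [Fintype n] [DecidableEq n] [Nonempty n] [Fintype m]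
    [DecidableEq m] {Q : Matrix (n × m) (n × m) ℂ} (hQ : Q ∈ testers n m) {v p : ℝ}
    (hvp : v ≤ p) (hp : p ≤ 1) :
    ∃ Q' ∈ testers n m, ∀ Φ, IsChannel Φ →
      accept Q Φ ≤ accept Q' Φ ∧ (accept Q Φ = v → accept Q' Φ = p) := by
  obtain ⟨s, hs⟩ := exists_isState n
  have hS : s ⊗ₖ (1 : Matrix m m ℂ) ∈ testers n m := by
    refine ⟨hs.1.kronecker PosSemidef.one, s, hs, ?_⟩
    rw [sub_self]
    exact PosSemidef.zero
  obtain ⟨c, hc0, hc1, hc⟩ : ∃ c : ℝ, 0 ≤ c ∧ c ≤ 1 ∧ (1 - c) * v + c = p := by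
    rcases (hvp.trans hp).eq_or_lt with rfl | hv
    · exact ⟨0, le_rfl, zero_le_one, by linarith⟩
    · have hv' : 0 < 1 - v := sub_pos.2 hv
      refine ⟨(p - v) / (1 - v), div_nonneg (sub_nonneg.2 hvp) hv'.le,
        (div_le_one hv').2 (by linarith), ?_⟩
      field_simp
      ring
  refine ⟨(1 - c) • Q + c • s ⊗ₖ (1 : Matrix m m ℂ),
    convex_testers n m hQ hS (sub_nonneg.2 hc1) hc0 (sub_add_cancel _ _), fun Φ hΦ => ?_⟩
  have : accept ((1 - c) • Q + c • s ⊗ₖ (1 : Matrix m m ℂ)) Φ = (1 - c) * accept Q Φ + c := by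
    rw [accept_apply, Matrix.add_mul, Matrix.smul_mul, Matrix.smul_mul, trace_add, trace_smul,
      trace_smul, trace_kronecker_one_mul_choi hΦ, hs.2]
    simp [accept_apply]
  rw [this]
  refine ⟨by nlinarith [accept_le_one hQ hΦ], fun h => by rw [h, hc]⟩

/-- A linear functional that is bounded above on the affine span of a set is constant on the
set. -/
theorem eq_of_le_on_affineSpan {V : Type*} [AddCommGroup V] [Module ℝ V] {S : Set V}
    (f : V →ₗ[ℝ] ℝ) {q : ℝ} (h : ∀ x ∈ affineSpan ℝ S, f x ≤ q) {x y : V} (hx : x ∈ S)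
    (hy : y ∈ S) : f x = f y := by
  by_contra hne
  have hd : f y - f x ≠ 0 := sub_ne_zero.2 (Ne.symm hne)
  -- The parameter is chosen so that `f` equals `q + 1` at this point of the line through `x` and
  -- `y`.
  have h1 := h _ (AffineMap.lineMap_mem ((q + 1 - f x) / (f y - f x))
    (subset_affineSpan ℝ S hx) (subset_affineSpan ℝ S hy))
  rw [AffineMap.lineMap_apply, vsub_eq_sub, vadd_eq_add, map_add, map_smul, map_sub, smul_eq_mul,
    div_mul_cancel₀ _ hd] at h1
  linarith

/-- The bound over the whole affine hull forces equal acceptance on all free channels, so after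
adjustment each of them is sent to the same free mixture. -/
theorem exists_conversion_of_maxRobustness_le {n m n' m' : Type*} [Fintype n] [DecidableEq n]
    [Nonempty n] [Fintype m] [DecidableEq m] [Fintype n'] [DecidableEq n'] [Nonempty n']
    [Fintype m'] [DecidableEq m'] {T : ResourceTheory n m} {T' : ResourceTheory n' m'}
    {E : SuperOp n m} (hE : E ∈ T.allowed) {N : SuperOp n' m'} (hN : N ∈ T'.allowed)
    (hconv : Convex ℝ T'.allowed)
    (hcl : IsClosed ((fun (Φ : SuperOp n' m') (X : Matrix n' n' ℂ) => Φ X) '' T'.allowed))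
    {ε δ : ℝ} (hε : 0 ≤ ε) (hε' : ε ≤ 1) (hδ : 0 ≤ δ)
    (h : smooth T' (maxRobustness T') ε N ≤
      hypTestMeasure (affineSpan ℝ T.free : Set (SuperOp n m)) δ E) :
    ∃ Θ ∈ freeSuperchannels T T', 1 - ε - 2 * δ ≤ channelFidelity (Θ E) N := by
  obtain ⟨p, hp, hp1, N', hN', hF, ⟨M', hM', hmix⟩, hpR⟩ := exists_optimal_mixture hN hcl
    T'.free_subset subset_rfl hcl hε
  obtain ⟨M₀, hM₀⟩ := T.free_nonempty
  obtain ⟨Q, hQ, hQE, hQM⟩ := exists_tester_forall_accept_le (affineSpan ℝ T.free).convex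
    ⟨M₀, subset_affineSpan ℝ _ hM₀⟩ hp (hpR.trans h)
  obtain ⟨Q', hQ', hacc⟩ := exists_tester_accept_eq hQ
    (hQM M₀ (subset_affineSpan ℝ _ hM₀)) hp1
  refine exists_conversion_of_tester hE hN hconv hε hε' hδ hQ'
    (hQE.trans (hacc E (T.allowed_isChannel E hE)).1) hN' hM' hF fun M hM => ?_
  rw [(hacc M (T.allowed_isChannel M (T.free_subset hM))).2
    (eq_of_le_on_affineSpan (accept Q) hQM hM hM₀)]
  exact hmix

end ChannelResource

end

theorem theorem1 {n m n' m' : Type*}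
    [Fintype n] [DecidableEq n] [Nonempty n] [Fintype m] [DecidableEq m]
    [Fintype n'] [DecidableEq n'] [Nonempty n'] [Fintype m'] [DecidableEq m']
    (T : ChannelResource.ResourceTheory n m) (T' : ChannelResource.ResourceTheory n' m')
    (E : ChannelResource.SuperOp n m) (hE : E ∈ T.allowed)
    (N : ChannelResource.SuperOp n' m') (hN : N ∈ T'.allowed) :
    -- necessary conditions
    (∀ ε : ℝ, 0 ≤ ε →
      (∃ Θ ∈ ChannelResource.freeSuperchannels T T',
        1 - ε ≤ ChannelResource.channelFidelity (Θ E) N) →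
      ∀ (R : ChannelResource.SuperOp n m → EReal) (R' : ChannelResource.SuperOp n' m' → EReal),
        ChannelResource.IsMonotone T T' R R' →
        ChannelResource.smooth T' R' ε N ≤ R E ∧
        ∀ δ : ℝ, 0 ≤ δ → δ ≤ 1 →
          ChannelResource.smooth T' R' (2 * (Real.sqrt δ + Real.sqrt ε)) N ≤
            ChannelResource.smooth T R δ E) ∧
    -- sufficient conditions
    (Convex ℝ T'.allowed →
      IsClosed ((fun (Φ : ChannelResource.SuperOp n' m') (X : Matrix n' n' ℂ) => Φ X) ''
        T'.allowed) →
      ∀ ε δ : ℝ, 0 ≤ ε → 0 ≤ δ → ε + 2 * δ < 1 →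
        (ChannelResource.smooth T' (ChannelResource.standardRobustness T') ε N ≤
            ChannelResource.hypTestMeasure T.free δ E ∨
          ChannelResource.smooth T' (ChannelResource.maxRobustness T') ε N ≤
            ChannelResource.hypTestMeasure (affineSpan ℝ T.free : Set _) δ E) →
        ∃ Θ ∈ ChannelResource.freeSuperchannels T T',
          1 - ε - 2 * δ ≤ ChannelResource.channelFidelity (Θ E) N) := by
  refine ⟨fun ε hε ⟨Θ, hΘ, hF⟩ R R' hR => ?_, fun hconv hcl ε δ hε hδ hεδ h => ?_⟩
  · obtain ⟨h₁, h₂⟩ := ChannelResource.smooth_le_of_conversion hE hN hε hΘ hF hR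
    exact ⟨h₁, fun δ hδ _ => h₂ δ hδ⟩
  · rcases h with h | h
    · exact ChannelResource.exists_conversion_of_standardRobustness_le hE hN hconv hcl hε
        (by linarith) hδ h
    · exact ChannelResource.exists_conversion_of_maxRobustness_le hE hN hconv hcl hε
        (by linarith) hδ h
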